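/- **Theorem (convergence of SGA).** Let $p=b+z$ with $b=2m$ even. For $w\in\mathbb R^{p(p-1)/2}$, indexed by the pairs $i>j$ in $\{1,\dots,p\}$, let $\mathcal A w$ be the symmetric $p\times p$ matrix with zero diagonal and off-diagonal entries $w_{ij}$, and let $\mathcal L w=\mathrm{Diag}(\mathcal A w\,\mathbf 1)-\mathcal A w$. Their adjoints are $[\mathcal A^*Y]_{ij}=Y_{ij}+Y_{ji}$ and $[\mathcal L^*Y]_{ij}=Y_{ii}-Y_{ij}-Y_{ji}+Y_{jj}$. Let $J=\frac1p\mathbf 1\mathbf 1^T$, $K=S+\alpha(2I-\mathbf 1\mathbf 1^T)$ with $S\in\mathbb R^{p\times p}$, $\alpha\in\mathbb R$, let $\gamma,c_1,c_2>0$, and $$\mathcal S_\psi=\{\psi\in\mathbb R^b:\ \psi_i=-\psi_{b+1-i}\ (1\le i\le b/2),\ \ c_1\ge\psi_1\ge\dots\ge\psi_{b/2}\ge c_2\}.$$ Consider the problem $$\min_{w,V,\psi}\ F(w,V,\psi)=-\log\det(\mathcal L w+J)+\mathrm{tr}(K\mathcal L w)+\tfrac{\gamma}{2}\|\mathcal A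 w-V\,\mathrm{Diag}(\psi)V^T\|_F^2\quad\text{s.t. } w\ge0,\ \psi\in\mathcal S_\psi,\ V\in\mathbb R^{p\times b},\ V^TV=I_b,\qquad(\ast)$$ where $-\log\det(\mathcal L w+J)=+\infty$ if the positive semidefinite matrix $\mathcal L w+J$ is singular. Start from a feasible $(w^0,V^0,\psi^0)$ with $F(w^0,V^0,\psi^0)<\infty$. Assume that $w\mapsto-\log\det(\mathcal L w+J)$ has an $L_2$-Lipschitz continuous gradient on the set of all $w$ for which some $(w,V,\psi)$ is feasible with $F(w,V,\psi)\le F(w^0,V^0,\psi^0)$. Put $L=2+L_2/\gamma$. For $t=0,1,2,\dots$ the SGA algorithm computes 1. $w^{t+1}=\Big(w^t-\frac1L\big(-\frac1\gamma\mathcal L^*(\mathcal L w^t+J)^{-1}+\mathcal A^*\mathcal A w^t-\tilde c\big)\Big)^+$ with $\tilde c=\mathcal A^*(V^t\mathrm{Diag}(\psi^t)(V^t)^T)-\gamma^{-1}\mathcal L^*K$ and $(a)^+=\max(a,0)$ entrywise; 2. $V^{t+1}$: the columns with positions $1,\dots,\frac{p-z}2,\frac{p+z}2+1,\dots,p$ of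 an orthonormal eigenbasis of $\mathcal A w^{t+1}$ ordered by decreasing eigenvalue (any choice of such a basis is allowed); 3. $\psi^{t+1}$: with $e=\mathrm{diag}((V^{t+1})^T\mathcal A w^{t+1}V^{t+1})$ and $\tilde e_i=\frac{e_i-e_{b+1-i}}2$, its first half is the minimizer of $\|\tilde\psi-\tilde e\|_2^2$ over $c_1\ge\tilde\psi_1\ge\dots\ge\tilde\psi_{b/2}\ge c_2$, and $\psi^{t+1}_{b+1-i}=-\psi^{t+1}_i$ for $i\le b/2$. Then $(w^t,V^t,\psi^t)$ converges to the set of KKT points of $(\ast)$: the distance of $(w^t,V^t,\psi^t)$ to this set (which in particular is non-empty) tends to $0$ as $t\to\infty$, and every limit point of the sequence is a KKT point of $(\ast)$. Here a KKT point is a feasible point with $\det(\mathcal L w+J)>0$ at which there are multipliers, non-negative and complementary for the inequality constraints and free for $\psi_i+\psi_{b+1-i}=0$ and $V^TV=I_b$, that make the Lagrangian stationary in $(w,V,\psi)$. -/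

import Mathlib

open scoped Matrix NNReal Topology Matrix.Norms.Frobenius

noncomputable section

namespace SGA

/-- The edges `{i, j}` of the complete graph on `p` nodes, each stored as the pair `(i, j)` with
`j < i`. They index the `p (p - 1) / 2` entries of a weight vector. -/
abbrev Edge (p : ℕ) : Type := {e : Fin p × Fin p // e.2 < e.1}

/-- Weight vectors `w ∈ ℝ^{p(p-1)/2}` with the Euclidean norm. -/
abbrev Weights (p : ℕ) : Type := EuclideanSpace ℝ (Edge p)

/-- The adjacency operator: zero diagonal, `[𝒜 w]_{ij} = [𝒜 w]_{ji} = w_{ij}` for `j < i`. -/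
def adj {p : ℕ} (w : Weights p) : Matrix (Fin p) (Fin p) ℝ :=
  Matrix.of fun i j =>
    if h : j < i then w ⟨(i, j), h⟩ else if h : i < j then w ⟨(j, i), h⟩ else 0

/-- The Laplacian operator: `[ℒ w]_{ij} = -w_{ij}` off the diagonal, and the `i`-th diagonal
entry is the sum of the weights of the edges at `i`. -/
def lap {p : ℕ} (w : Weights p) : Matrix (Fin p) (Fin p) ℝ :=
  Matrix.of fun i j => if i = j then ∑ k, adj w i k else - adj w i j

/-- The adjoint `𝒜*` of `𝒜`. -/
def adjStar {p : ℕ} (Y : Matrix (Fin p) (Fin p) ℝ) : Weights p :=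
  WithLp.toLp 2 fun e => Y e.1.1 e.1.2 + Y e.1.2 e.1.1

/-- The adjoint `ℒ*` of `ℒ`. -/
def lapStar {p : ℕ} (Y : Matrix (Fin p) (Fin p) ℝ) : Weights p :=
  WithLp.toLp 2 fun e => Y e.1.1 e.1.1 - Y e.1.1 e.1.2 - Y e.1.2 e.1.1 + Y e.1.2 e.1.2

/-- The matrix `J = (1/p) 1 1ᵀ`. -/
def J (p : ℕ) : Matrix (Fin p) (Fin p) ℝ := Matrix.of fun _ _ => 1 / (p : ℝ)

/-- The input of the problem: the data matrix `S`, the sparsity parameter `α`, the penalty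
parameter `γ` and the bounds `c₁`, `c₂` of the adjacency eigenvalues. -/
structure Params (p : ℕ) where
  S : Matrix (Fin p) (Fin p) ℝ
  α : ℝ
  γ : ℝ
  c₁ : ℝ
  c₂ : ℝ

/-- `K = S + H` with `H = α (2 I - 1 1ᵀ)`. -/
def Params.K {p : ℕ} (P : Params p) : Matrix (Fin p) (Fin p) ℝ :=
  P.S + P.α • ((2 : ℝ) • (1 : Matrix (Fin p) (Fin p) ℝ) - Matrix.of fun _ _ => 1)

/-- Vectors `ψ ∈ ℝ^b`, `b = 2 m`, with the Euclidean norm. -/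
abbrev Spectra (m : ℕ) : Type := EuclideanSpace ℝ (Fin (2 * m))

/-- The optimization variable `(w, V, ψ)`. -/
abbrev Var (p m : ℕ) : Type := Weights p × Matrix (Fin p) (Fin (2 * m)) ℝ × Spectra m

/-- The `i`-th position of the first half of `1, …, 2 m`. -/
def halfIdx {m : ℕ} (i : Fin m) : Fin (2 * m) := Fin.castLE (by omega) i

/-- The first half of `ψ`. -/
def half {m : ℕ} (ψ : Spectra m) : Fin m → ℝ := fun i => ψ (halfIdx i)

/-- The successive differences `c₁ - x₁, x₁ - x₂, …, x_{m-1} - x_m, x_m - c₂` of a chain. -/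
def chainGap {m : ℕ} (c₁ c₂ : ℝ) (x : Fin m → ℝ) (k : Fin (m + 1)) : ℝ :=
  let y : Fin (m + 2) → ℝ :=
    Fin.cons (α := fun _ => ℝ) c₁ (Fin.snoc (α := fun _ => ℝ) x c₂)
  y k.castSucc - y k.succ

/-- The chain constraint `c₁ ≥ x₁ ≥ ⋯ ≥ x_m ≥ c₂`. -/
def chainSet (m : ℕ) (c₁ c₂ : ℝ) : Set (Fin m → ℝ) := {x | ∀ k, 0 ≤ chainGap c₁ c₂ x k}

/-- The spectral set `𝒮_ψ`: `ψ_i = -ψ_{b+1-i}` and `c₁ ≥ ψ₁ ≥ ⋯ ≥ ψ_{b/2} ≥ c₂`. -/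
def spectralSet (m : ℕ) (c₁ c₂ : ℝ) : Set (Spectra m) :=
  {ψ | (∀ i : Fin m, ψ (halfIdx i) = - ψ (halfIdx i).rev) ∧ half ψ ∈ chainSet m c₁ c₂}

/-- The term `-log det (ℒ w + J)`. -/
def negLogDet {p : ℕ} (w : Weights p) : ℝ := - Real.log (lap w + J p).det

/-- The objective
`-log det (ℒ w + J) + tr (K ℒ w) + (γ/2) ‖𝒜 w - V Diag(ψ) Vᵀ‖_F²`. -/
def cost {p m : ℕ} (P : Params p) (x : Var p m) : ℝ :=
  negLogDet x.1 + (P.K * lap x.1).trace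
    + P.γ / 2 * ‖adj x.1 - x.2.1 * Matrix.diagonal (x.2.2 : Fin (2 * m) → ℝ) * x.2.1ᵀ‖ ^ 2

/-- Feasible points at which the objective is finite: `w ≥ 0`, `ψ ∈ 𝒮_ψ`, `Vᵀ V = I`, and
`det (ℒ w + J) > 0` (`ℒ w + J` is positive semidefinite for `w ≥ 0`, so this only says that it is
invertible; `-log det` is `+∞` otherwise). -/
def feasible {p m : ℕ} (P : Params p) : Set (Var p m) :=
  {x | (∀ e, 0 ≤ x.1 e) ∧ 0 < (lap x.1 + J p).det ∧ x.2.1ᵀ * x.2.1 = 1 ∧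
    x.2.2 ∈ spectralSet m P.c₁ P.c₂}

/-- The sublevel set `{x feasible : F x ≤ F x₀}` of the objective. -/
def levelSet {p m : ℕ} (P : Params p) (x₀ : Var p m) : Set (Var p m) :=
  {x | x ∈ feasible P ∧ cost P x ≤ cost P x₀}

/-- The Lagrangian, with multipliers `μ₁` for `w ≥ 0`, `μ₂` for the chain constraint, `ν` for
the symmetry `ψ_i + ψ_{b+1-i} = 0`, and `M` for `Vᵀ V = I`. -/
def lagrangian {p m : ℕ} (P : Params p) (μ₁ : Edge p → ℝ) (μ₂ : Fin (m + 1) → ℝ)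
    (ν : Fin m → ℝ) (M : Matrix (Fin (2 * m)) (Fin (2 * m)) ℝ) (x : Var p m) : ℝ :=
  cost P x - ∑ e, μ₁ e * x.1 e - ∑ k, μ₂ k * chainGap P.c₁ P.c₂ (half x.2.2) k
    + ∑ i, ν i * (x.2.2 (halfIdx i) + x.2.2 (halfIdx i).rev)
    + (Mᵀ * (x.2.1ᵀ * x.2.1 - 1)).trace

/-- The KKT points of
`minimize F(w, V, ψ) subject to w ≥ 0, ψ ∈ 𝒮_ψ, Vᵀ V = I`: primal feasibility, dual feasibility,
complementary slackness, and stationarity of the Lagrangian in `(w, V, ψ)` jointly. -/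
def kktSet {p m : ℕ} (P : Params p) : Set (Var p m) :=
  {x | x ∈ feasible P ∧
    ∃ (μ₁ : Edge p → ℝ) (μ₂ : Fin (m + 1) → ℝ) (ν : Fin m → ℝ)
      (M : Matrix (Fin (2 * m)) (Fin (2 * m)) ℝ),
      (∀ e, 0 ≤ μ₁ e) ∧ (∀ k, 0 ≤ μ₂ k) ∧
      (∀ e, μ₁ e * x.1 e = 0) ∧
      (∀ k, μ₂ k * chainGap P.c₁ P.c₂ (half x.2.2) k = 0) ∧
      HasFDerivAt (𝕜 := ℝ) (lagrangian P μ₁ μ₂ ν M) 0 x}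

/-- `c̃ = 𝒜*(V Diag(ψ) Vᵀ) - γ⁻¹ ℒ* K`. -/
def cTilde {p m : ℕ} (P : Params p) (V : Matrix (Fin p) (Fin (2 * m)) ℝ) (ψ : Spectra m) :
    Weights p :=
  adjStar (V * Matrix.diagonal (ψ : Fin (2 * m) → ℝ) * Vᵀ) - P.γ⁻¹ • lapStar P.K

/-- The `w`-update: `w⁺ = (w - (1/L) ∇h(w))⁺` with `L = 2 + L₂/γ` and
`∇h(w) = -γ⁻¹ ℒ*((ℒ w + J)⁻¹) + 𝒜* 𝒜 w - c̃`, the gradient of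
`h(w) = -γ⁻¹ log det (ℒ w + J) + ½ ‖𝒜 w‖_F² - c̃ᵀ w`. -/
def wUpdate {p m : ℕ} (P : Params p) (L₂ : ℝ) (x : Var p m) : Weights p :=
  let L : ℝ := 2 + L₂ / P.γ
  let grad : Weights p :=
    - (P.γ⁻¹ • lapStar (lap x.1 + J p)⁻¹) + adjStar (adj x.1) - cTilde P x.2.1 x.2.2
  WithLp.toLp 2 fun e => max (x.1 e - 1 / L * grad e) 0

/-- With `b = 2 m` and `p = b + z`, the position in `1, …, p` of the `j`-th entry of the list
`1, …, (p - z)/2, (p + z)/2 + 1, …, p`. -/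
def eigIdx {p m z : ℕ} (hp : p = 2 * m + z) (j : Fin (2 * m)) : Fin p :=
  ⟨if (j : ℕ) < m then j else j + z, by have := j.isLt; split <;> omega⟩

/-- `V = eigenvectors(A)[1 : (p - z)/2, (p + z)/2 + 1 : p]`: the columns of `V` are those in these
positions of some orthonormal eigenbasis of `A`, ordered by decreasing eigenvalue. -/
def IsEigUpdate {p m z : ℕ} (hp : p = 2 * m + z) (A : Matrix (Fin p) (Fin p) ℝ)
    (V : Matrix (Fin p) (Fin (2 * m)) ℝ) : Prop :=
  ∃ (Q : Matrix (Fin p) (Fin p) ℝ) (d : Fin p → ℝ), Qᵀ * Q = 1 ∧ Antitone d ∧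
    A * Q = Q * Matrix.diagonal d ∧ ∀ i j, V i j = Q i (eigIdx hp j)

/-- The `ψ`-update: with `e = diag(Vᵀ (𝒜 w) V)` and `ẽ_i = (e_i - e_{b+1-i})/2`, the first half of
`ψ` minimizes `‖ψ̃ - ẽ‖²` over `c₁ ≥ ψ̃₁ ≥ ⋯ ≥ ψ̃_{b/2} ≥ c₂`, and the second half is given by
`ψ_{b+1-i} = -ψ_i`. -/
def IsPsiUpdate {p m : ℕ} (P : Params p) (w : Weights p)
    (V : Matrix (Fin p) (Fin (2 * m)) ℝ) (ψ : Spectra m) : Prop :=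
  let e : Fin (2 * m) → ℝ := fun j => (Vᵀ * adj w * V) j j
  let eTilde : Fin m → ℝ := fun i => (e (halfIdx i) - e (halfIdx i).rev) / 2
  half ψ ∈ chainSet m P.c₁ P.c₂ ∧
    IsMinOn (fun y : Fin m → ℝ => ∑ i, (y i - eTilde i) ^ 2) (chainSet m P.c₁ P.c₂) (half ψ) ∧
    ∀ i : Fin m, ψ (halfIdx i).rev = - ψ (halfIdx i)

/-- One iteration of the algorithm: update `w`, then `V`, then `ψ`. -/
def IsStep {p m z : ℕ} (hp : p = 2 * m + z) (P : Params p) (L₂ : ℝ) (x x' : Var p m) : Prop :=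
  x'.1 = wUpdate P L₂ x ∧ IsEigUpdate hp (adj x'.1) x'.2.1 ∧ IsPsiUpdate P x'.1 x'.2.1 x'.2.2

end SGA

end

/-! Each iteration lowers the cost, and by at least $\frac{2\gamma+L_2}{2}\|w^{t+1}-w^t\|^2$. The
$w$-update is a projected gradient step with step size $1/L$, and $\gamma L=2\gamma+L_2$ bounds the
Lipschitz constant of the $w$-gradient of the cost. Since the Lipschitz hypothesis covers only
weights occurring in the level set, the segment from $w^t$ to $w^{t+1}$ must first be shown to stay
there (`descent_on_segment`, `cost_wUpdate_le`). The other two updates are exact block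
minimizations: a Ky Fan trace inequality for $V$ (`IsEigUpdate.cost_le`) and a completed square for
$\psi$ (`IsPsiUpdate.cost_le`).

The level set is compact (`isCompact_levelSet`): the penalty grows quadratically in $w$, the
remaining terms decrease at most linearly, and $V$, $\psi$ are bounded. So the costs are bounded
below and $w^{t+1}-w^t\to0$.

The differences of $V^t$ need not vanish, because eigenbases are not unique. This does no harm: for
$t\ge1$ the blocks $V^t$, $\psi^t$ were computed from the same $w^t$, and what is needed of them (an
eigenvector equation and the optimality of $\psi^t$) is a closed condition on a single iterate. A
limit point therefore inherits these conditions and is fixed by the $w$-update, and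
`mem_kktSet_of_fixed` writes down its multipliers. Compactness turns this into convergence of the
distance. -/

namespace SGA

open Filter

/-! ### The operators, their adjoints and the Frobenius norm. -/

section Operators

variable {p : ℕ}

lemma adj_apply (w : Weights p) (i j : Fin p) :
    adj w i j = if h : j < i then w ⟨(i, j), h⟩ else if h : i < j then w ⟨(j, i), h⟩ else 0 := rfl

lemma lap_apply (w : Weights p) (i j : Fin p) :
    lap w i j = if i = j then ∑ k, adj w i k else - adj w i j := rfl

lemma adj_self (w : Weights p) (i : Fin p) : adj w i i = 0 := by simp [adj_apply]

lemma adj_edge (w : Weights p) (e : Edge p) : adj w e.1.1 e.1.2 = w e := by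
  simp [adj_apply, e.2]

lemma adj_symm (w : Weights p) (i j : Fin p) : adj w i j = adj w j i := by
  rcases lt_trichotomy i j with h | h | h
  · simp [adj_apply, h, h.not_gt]
  · simp [h]
  · simp [adj_apply, h, h.not_gt]

lemma adj_transpose (w : Weights p) : (adj w)ᵀ = adj w := by
  ext i j; exact adj_symm w j i

lemma adj_add (u v : Weights p) : adj (u + v) = adj u + adj v := by
  ext i j
  simp only [adj_apply, Matrix.add_apply, PiLp.add_apply]
  split_ifs <;> simp

lemma adj_smul (c : ℝ) (v : Weights p) : adj (c • v) = c • adj v := by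
  ext i j
  simp only [adj_apply, Matrix.smul_apply, PiLp.smul_apply]
  split_ifs <;> simp

lemma lap_add (u v : Weights p) : lap (u + v) = lap u + lap v := by
  ext i j
  simp only [lap_apply, Matrix.add_apply, adj_add]
  split_ifs
  · rw [Finset.sum_add_distrib]
  · ring

lemma lap_smul (c : ℝ) (v : Weights p) : lap (c • v) = c • lap v := by
  ext i j
  simp only [lap_apply, Matrix.smul_apply, adj_smul, smul_eq_mul]
  split_ifs
  · rw [Finset.mul_sum]
  · ring

lemma lap_symm (w : Weights p) (i j : Fin p) : lap w i j = lap w j i := by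
  rw [lap_apply, lap_apply]
  by_cases h : i = j
  · subst h; rfl
  · rw [if_neg h, if_neg (Ne.symm h), adj_symm]

lemma sum_mul_adj (Y : Matrix (Fin p) (Fin p) ℝ) (w : Weights p) :
    ∑ i, ∑ j, Y i j * adj w i j = inner ℝ (adjStar Y) w := by
  have split : ∀ i j : Fin p, Y i j * adj w i j =
      (if j < i then Y i j * adj w i j else 0) + (if i < j then Y i j * adj w i j else 0) := by
    intro i j
    rcases lt_trichotomy i j with h | h | h
    · simp [h, h.not_gt]
    · simp [h, adj_self]
    · simp [h, h.not_gt]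
  have flip : ∑ i, ∑ j, (if i < j then Y i j * adj w i j else 0)
      = ∑ i, ∑ j, (if j < i then Y j i * adj w i j else 0) := by
    rw [Finset.sum_comm]
    refine Finset.sum_congr rfl fun i _ => Finset.sum_congr rfl fun j _ => ?_
    rw [adj_symm]
  have edges : ∀ f : Fin p → Fin p → ℝ, ∑ i, ∑ j, (if j < i then f i j else 0)
      = ∑ e : Edge p, f e.1.1 e.1.2 := by
    intro f
    rw [← Fintype.sum_prod_type' (f := fun i j => if j < i then f i j else 0),
      ← Finset.sum_filter]
    exact Finset.sum_subtype _ (by simp) (fun e : Fin p × Fin p => f e.1 e.2)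
  calc ∑ i, ∑ j, Y i j * adj w i j
      = ∑ i, ∑ j, (if j < i then Y i j * adj w i j + Y j i * adj w i j else 0) := by
        rw [Finset.sum_congr rfl fun i _ => Finset.sum_congr rfl fun j _ => split i j]
        simp_rw [Finset.sum_add_distrib]
        rw [flip, ← Finset.sum_add_distrib]
        refine Finset.sum_congr rfl fun i _ => ?_
        rw [← Finset.sum_add_distrib]
        refine Finset.sum_congr rfl fun j _ => ?_
        split_ifs <;> simp
    _ = inner ℝ (adjStar Y) w := by
        rw [edges (fun i j => Y i j * adj w i j + Y j i * adj w i j), PiLp.inner_apply]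
        refine Finset.sum_congr rfl fun e _ => ?_
        simp only [adj_edge, adjStar, RCLike.inner_apply, conj_trivial]
        ring

/-- Spreading the degree on the diagonal over its row turns the pairing of `Y` with `lap w` into a
pairing of `Y i i - Y i j` with `adj w`. -/
lemma sum_mul_lap (Y : Matrix (Fin p) (Fin p) ℝ) (w : Weights p) :
    ∑ i, ∑ j, Y i j * lap w i j = inner ℝ (lapStar Y) w := by
  have h : ∑ i, ∑ j, Y i j * lap w i j
      = ∑ i, ∑ j, (Matrix.of fun i j => Y i i - Y i j : Matrix (Fin p) (Fin p) ℝ) i j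
        * adj w i j := by
    refine Finset.sum_congr rfl fun i _ => ?_
    have h1 : ∀ j, Y i j * lap w i j =
        (if i = j then Y i i * ∑ k, adj w i k else 0) - Y i j * adj w i j := by
      intro j
      rw [lap_apply]
      split_ifs with h
      · subst h; simp [adj_self]
      · ring
    simp_rw [h1, Finset.sum_sub_distrib, Finset.sum_ite_eq, Finset.mem_univ, if_true,
      Finset.mul_sum, ← Finset.sum_sub_distrib, Matrix.of_apply, sub_mul]
  rw [h, sum_mul_adj]
  congr 1
  ext e
  simp only [adjStar, lapStar, Matrix.of_apply]
  ring

lemma trace_mul_lap (Y : Matrix (Fin p) (Fin p) ℝ) (w : Weights p) :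
    (Y * lap w).trace = inner ℝ (lapStar Y) w := by
  rw [← sum_mul_lap]
  simp only [Matrix.trace, Matrix.diag_apply, Matrix.mul_apply]
  refine Finset.sum_congr rfl fun i _ => Finset.sum_congr rfl fun j _ => ?_
  rw [lap_symm]

lemma adjStar_adj (w : Weights p) : adjStar (adj w) = (2 : ℝ) • w := by
  ext e
  simp only [adjStar, PiLp.smul_apply, smul_eq_mul]
  rw [adj_symm w e.1.2, adj_edge]
  ring

lemma sum_adj_sq (w : Weights p) : ∑ i, ∑ j, adj w i j ^ 2 = 2 * ‖w‖ ^ 2 := by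
  simp_rw [sq (adj w _ _)]
  rw [sum_mul_adj, adjStar_adj, real_inner_smul_left, real_inner_self_eq_norm_sq]

lemma adjStar_sub (X Y : Matrix (Fin p) (Fin p) ℝ) : adjStar (X - Y) = adjStar X - adjStar Y := by
  ext e; simp only [adjStar, PiLp.sub_apply, Matrix.sub_apply]; ring

lemma frobenius_sq {m n : Type*} [Fintype m] [Fintype n] (M : Matrix m n ℝ) :
    ‖M‖ ^ 2 = ∑ i, ∑ j, M i j ^ 2 := by
  rw [Matrix.frobenius_norm_def, ← Real.sqrt_eq_rpow, Real.sq_sqrt (by positivity)]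
  simp

end Operators

/-! ### Continuity, differentiability and the gradient of the log-determinant. -/

section Regularity

variable {p : ℕ} {E : Type*}

@[fun_prop]
lemma continuous_adj_apply [TopologicalSpace E] {f : E → Weights p} (hf : Continuous f)
    (i j : Fin p) : Continuous fun x => adj (f x) i j := by
  simp only [adj_apply]
  split_ifs <;> fun_prop

@[fun_prop]
lemma continuous_lap_apply [TopologicalSpace E] {f : E → Weights p} (hf : Continuous f)
    (i j : Fin p) : Continuous fun x => lap (f x) i j := by
  simp only [lap_apply]
  split_ifs <;> fun_prop

@[fun_prop]
lemma continuous_lap [TopologicalSpace E] {f : E → Weights p} (hf : Continuous f) :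
    Continuous fun x => lap (f x) :=
  continuous_matrix fun i j => by fun_prop

@[fun_prop]
lemma continuous_adj [TopologicalSpace E] {f : E → Weights p} (hf : Continuous f) :
    Continuous fun x => adj (f x) :=
  continuous_matrix fun i j => by fun_prop

@[fun_prop]
lemma continuous_det_lap [TopologicalSpace E] {f : E → Weights p} (hf : Continuous f) :
    Continuous fun x => (lap (f x) + J p).det := by
  fun_prop

variable [NormedAddCommGroup E] [NormedSpace ℝ E]

@[fun_prop]
lemma differentiable_adj_apply {f : E → Weights p} (hf : Differentiable ℝ f)
    (i j : Fin p) : Differentiable ℝ fun x => adj (f x) i j := by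
  simp only [adj_apply]
  split_ifs <;> fun_prop

@[fun_prop]
lemma differentiable_lap_apply {f : E → Weights p} (hf : Differentiable ℝ f)
    (i j : Fin p) : Differentiable ℝ fun x => lap (f x) i j := by
  simp only [lap_apply]
  split_ifs <;> fun_prop

lemma differentiable_det_lap {f : E → Weights p} (hf : Differentiable ℝ f) :
    Differentiable ℝ fun x => (lap (f x) + J p).det := by
  simp only [Matrix.det_apply, Matrix.add_apply]
  fun_prop

lemma differentiableAt_negLogDet {w : Weights p} (h : (lap w + J p).det ≠ 0) :
    DifferentiableAt ℝ negLogDet w :=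
  ((differentiable_det_lap differentiable_id w).log h).neg

/-- Jacobi's formula: after factoring out `M`, the determinant of `1 + s • (M⁻¹ * N)` is a
polynomial in `s` with linear coefficient the trace; `R` is what is left after dividing by `s ^ 2`.
-/
lemma hasDerivAt_det_add_smul {n : Type*} [Fintype n] [DecidableEq n] (M N : Matrix n n ℝ)
    (h : M.det ≠ 0) :
    HasDerivAt (fun s : ℝ => (M + s • N).det) (M.det * (M⁻¹ * N).trace) 0 := by
  have hM : M * M⁻¹ = 1 := Matrix.mul_nonsing_inv M (isUnit_iff_ne_zero.mpr h)
  set R := (1 + (Polynomial.X : Polynomial ℝ) • (M⁻¹ * N).map Polynomial.C).det.divX.divX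
  have key : ∀ s : ℝ, (M + s • N).det
      = M.det * (1 + (M⁻¹ * N).trace * s + R.eval s * s ^ 2) := by
    intro s
    rw [← Matrix.det_one_add_smul, ← Matrix.det_mul, mul_add, mul_one, Matrix.mul_smul,
      ← Matrix.mul_assoc, hM, Matrix.one_mul]
  have h1 : HasDerivAt (fun s : ℝ => M.det * (1 + (M⁻¹ * N).trace * s + R.eval s * s ^ 2))
      (M.det * ((M⁻¹ * N).trace * 1 + (R.derivative.eval 0 * 0 ^ 2
        + R.eval 0 * (((2 : ℕ) : ℝ) * 0 ^ (2 - 1) * 1)))) 0 := by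
    refine HasDerivAt.const_mul _ (HasDerivAt.add ?_ ?_)
    · exact ((hasDerivAt_id (0 : ℝ)).const_mul _).const_add 1
    · exact (R.hasDerivAt 0).mul ((hasDerivAt_id (0 : ℝ)).pow 2)
  rw [show (fun s : ℝ => (M + s • N).det) = _ from funext key]
  convert h1 using 1
  simp

lemma hasGradientAt_negLogDet {w : Weights p} (h : 0 < (lap w + J p).det) :
    HasGradientAt negLogDet (- lapStar (lap w + J p)⁻¹) w := by
  have hd := differentiableAt_negLogDet h.ne'
  rw [hasGradientAt_iff_hasFDerivAt]
  refine hd.hasFDerivAt.congr_fderiv (ContinuousLinearMap.ext fun v => ?_)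
  have h1 : HasDerivAt (fun s : ℝ => negLogDet (w + s • v)) (fderiv ℝ negLogDet w v) 0 := by
    have h0 : HasDerivAt (fun s : ℝ => w + s • v) v 0 := by
      simpa using ((hasDerivAt_id (0 : ℝ)).smul_const v).const_add w
    have h2 : HasFDerivAt negLogDet (fderiv ℝ negLogDet w) (w + (0 : ℝ) • v) := by
      simpa using hd.hasFDerivAt
    exact h2.comp_hasDerivAt 0 h0
  have h2 : HasDerivAt (fun s : ℝ => negLogDet (w + s • v))
      (-(((lap w + J p).det * ((lap w + J p)⁻¹ * lap v).trace) / (lap w + J p).det)) 0 := by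
    have h3 := (hasDerivAt_det_add_smul (lap w + J p) (lap v) h.ne').log (by simpa using h.ne')
    have h4 : (fun s : ℝ => negLogDet (w + s • v))
        = fun s : ℝ => - Real.log ((lap w + J p) + s • lap v).det := by
      ext s
      rw [negLogDet, lap_add, lap_smul, add_right_comm]
    rw [h4]
    simpa only [zero_smul, add_zero] using h3.fun_neg
  rw [h1.unique h2, mul_div_cancel_left₀ _ h.ne', trace_mul_lap]
  simp

end Regularity

/-! ### Sufficient decrease of the projected gradient step. -/

section Descent

/-- A descent lemma whose slope bound is available only where `f` is defined (`0 < D`) and has not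
risen above `f 0`. There `f' s ≤ -a * (1 - s)`, which is negative before `s = 1`, so `f` cannot
leave this closed set; integrating the bound gives the decrease `a / 2`. -/
lemma descent_on_segment {f D f' : ℝ → ℝ} {a : ℝ} (ha : 0 < a) (hD : Continuous D)
    (hcl : IsClosed {s | 0 < D s ∧ f s ≤ f 0}) (hD0 : 0 < D 0)
    (hder : ∀ s, 0 < D s → HasDerivAt f (f' s) s) (h0 : f' 0 ≤ -a)
    (hlip : ∀ s ∈ Set.Icc (0 : ℝ) 1, 0 < D s → f s ≤ f 0 → f' s ≤ f' 0 + a * s) :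
    0 < D 1 ∧ f 1 ≤ f 0 - a / 2 := by
  set G : Set ℝ := {s | 0 < D s ∧ f s ≤ f 0} with hG
  have h0G : (0 : ℝ) ∈ G := ⟨hD0, le_rfl⟩
  -- Continuous induction on the property that all of `[0, s]` lies in `G`.
  have hsub : Set.Icc (0 : ℝ) 1 ⊆ {s | Set.Icc 0 s ⊆ G} := by
    refine IsClosed.Icc_subset_of_forall_exists_gt ?_ ?_ ?_
    · rw [← isSeqClosed_iff_isClosed]
      intro u s hu hs
      have hs01 : s ∈ Set.Icc (0 : ℝ) 1 := isClosed_Icc.mem_of_tendsto hs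
        (Eventually.of_forall fun n => (hu n).2)
      refine ⟨fun r hr => ?_, hs01⟩
      rcases hr.2.lt_or_eq with h | h
      · obtain ⟨n, hn⟩ := (hs.eventually (lt_mem_nhds h)).exists
        exact (hu n).1 ⟨hr.1, hn.le⟩
      · subst h
        exact hcl.mem_of_tendsto hs (Eventually.of_forall fun n => (hu n).1 ⟨(hu n).2.1, le_rfl⟩)
    · simpa using h0G
    · rintro x ⟨hxG, hx0, hx1⟩ y (hy : x < y)
      have hx : x ∈ G := hxG ⟨hx0, le_rfl⟩
      have hneg : f' x < 0 := by
        have := hlip x ⟨hx0, hx1.le⟩ hx.1 hx.2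
        nlinarith
      have hslope := (hasDerivWithinAt_iff_tendsto_slope' Set.self_notMem_Ioi).1
        ((hder x hx.1).hasDerivWithinAt (s := Set.Ioi x))
      have h1 : ∀ᶠ r in 𝓝[>] x, r ∈ G := by
        filter_upwards [hslope.eventually (gt_mem_nhds hneg), self_mem_nhdsWithin,
          nhdsWithin_le_nhds (hD.continuousAt.eventually (lt_mem_nhds hx.1))] with r hr hxr hDr
        refine ⟨hDr, ?_⟩
        rw [slope_def_field, div_neg_iff] at hr
        have hxr' : x < r := hxr
        rcases hr with h | h
        · linarith [h.2]
        · linarith [h.1, hx.2]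
      obtain ⟨u, hxu, hu⟩ := mem_nhdsGT_iff_exists_Ioo_subset.1 h1
      have hxu' : x < u := hxu
      refine ⟨min y ((x + u) / 2), fun r hr => ?_, lt_min hy (by linarith), min_le_left _ _⟩
      rcases le_or_gt r x with h | h
      · exact hxG ⟨hr.1, h⟩
      · exact hu ⟨h, lt_of_le_of_lt (hr.2.trans (min_le_right _ _)) (by linarith)⟩
  have hall : ∀ s ∈ Set.Icc (0 : ℝ) 1, s ∈ G := fun s hs => hsub hs ⟨hs.1, le_rfl⟩
  -- The subtracted parabola has derivative `-a * (1 - s)`, the upper bound for `f'`.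
  have hder' : ∀ s ∈ Set.Icc (0 : ℝ) 1,
      HasDerivAt (fun s => f s + a * s - a / 2 * s ^ 2) (f' s + a - a * s) s := by
    intro s hs
    refine (((hder s (hall s hs).1).fun_add ((hasDerivAt_id' s).const_mul a)).fun_sub
      (((hasDerivAt_id' s).fun_pow 2).const_mul (a / 2))).congr_deriv ?_
    push_cast
    ring
  have hanti : AntitoneOn (fun s => f s + a * s - a / 2 * s ^ 2) (Set.Icc 0 1) := by
    refine antitoneOn_of_deriv_nonpos (convex_Icc 0 1)
      (fun s hs => (hder' s hs).continuousAt.continuousWithinAt) ?_ ?_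
    · rw [interior_Icc]
      exact fun s hs =>
        (hder' s (Set.Ioo_subset_Icc_self hs)).differentiableAt.differentiableWithinAt
    · rw [interior_Icc]
      intro s hs
      have hs' := Set.Ioo_subset_Icc_self hs
      rw [(hder' s hs').deriv]
      linarith [hlip s hs' (hall s hs').1 (hall s hs').2]
  have h1 := hanti (Set.left_mem_Icc.2 zero_le_one) (Set.right_mem_Icc.2 zero_le_one) zero_le_one
  refine ⟨(hall 1 (by simp)).1, ?_⟩
  norm_num at h1
  linarith

variable {p m : ℕ} (P : Params p)

/-- The part `tr (K ℒ w) + (γ/2) ‖𝒜 w - V Diag(ψ) Vᵀ‖_F²` of the objective. -/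
noncomputable def quadCost (x : Var p m) : ℝ :=
  (P.K * lap x.1).trace
    + P.γ / 2 * ‖adj x.1 - x.2.1 * Matrix.diagonal (x.2.2 : Fin (2 * m) → ℝ) * x.2.1ᵀ‖ ^ 2

lemma cost_eq (x : Var p m) : cost P x = negLogDet x.1 + quadCost P x := add_assoc _ _ _

lemma quadCost_eq_sum (x : Var p m) : quadCost P x = ∑ i, ∑ j, P.K i j * lap x.1 j i
    + P.γ / 2 * ∑ i, ∑ j, (adj x.1 i j - ∑ k, x.2.1 i k * x.2.2 k * x.2.1 j k) ^ 2 := by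
  rw [quadCost, frobenius_sq]
  simp [Matrix.trace, Matrix.mul_apply, Matrix.diagonal_apply]

lemma differentiable_quadCost : Differentiable ℝ (quadCost P (m := m)) := by
  rw [show quadCost P (m := m) = _ from funext (quadCost_eq_sum P)]
  fun_prop

lemma continuous_quadCost : Continuous (quadCost P (m := m)) :=
  (differentiable_quadCost P).continuous

/-- Exponentiating removes the logarithm: both sides of the new inequality are continuous
everywhere, so sublevel sets are closed even near singular matrices. -/
lemma cost_le_iff {x : Var p m} {c : ℝ} : 0 < (lap x.1 + J p).det ∧ cost P x ≤ c ↔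
    Real.exp (quadCost P x - c) ≤ (lap x.1 + J p).det := by
  constructor
  · rintro ⟨h, hc⟩
    rw [← Real.le_log_iff_exp_le h]
    rw [cost_eq, negLogDet] at hc
    linarith
  · intro h
    have h' := (Real.exp_pos _).trans_le h
    refine ⟨h', ?_⟩
    rw [← Real.le_log_iff_exp_le h'] at h
    rw [cost_eq, negLogDet]
    linarith

lemma isClosed_cost_le (c : ℝ) :
    IsClosed {x : Var p m | 0 < (lap x.1 + J p).det ∧ cost P x ≤ c} := by
  simp only [cost_le_iff]
  have := continuous_quadCost P (m := m)
  exact isClosed_le (by fun_prop) (continuous_det_lap continuous_fst)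

/-- The gradient used in the `w`-update. -/
noncomputable def stepGrad (x : Var p m) : Weights p :=
  - (P.γ⁻¹ • lapStar (lap x.1 + J p)⁻¹) + adjStar (adj x.1) - cTilde P x.2.1 x.2.2

lemma wUpdate_apply (L₂ : ℝ) (x : Var p m) (e : Edge p) :
    wUpdate P L₂ x e = max (x.1 e - 1 / (2 + L₂ / P.γ) * stepGrad P x e) 0 := rfl

/-- The right side is the gradient of the cost in `w`: the algorithm works with the cost divided by
`γ`. -/
lemma smul_stepGrad (hγ : 0 < P.γ) (x : Var p m) :
    P.γ • stepGrad P x = - lapStar (lap x.1 + J p)⁻¹ + (lapStar P.K + P.γ • adjStar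
      (adj x.1 - x.2.1 * Matrix.diagonal (x.2.2 : Fin (2 * m) → ℝ) * x.2.1ᵀ)) := by
  rw [stepGrad, cTilde, adjStar_sub]
  simp only [smul_sub, smul_add, smul_neg, smul_smul, mul_inv_cancel₀ hγ.ne', one_smul]
  abel

/-- Each weight occurs twice in `adj d`, whose squared norm is therefore `2 * ‖d‖ ^ 2`; this is the
`2` in `L = 2 + L₂ / γ`. -/
lemma quadCost_line (w d : Weights p) (y : Matrix (Fin p) (Fin (2 * m)) ℝ × Spectra m) (s : ℝ) :
    quadCost P (w + s • d, y) = quadCost P (w, y) + s * inner ℝ (lapStar P.K + P.γ • adjStar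
      (adj w - y.1 * Matrix.diagonal (y.2 : Fin (2 * m) → ℝ) * y.1ᵀ)) d
      + P.γ * s ^ 2 * ‖d‖ ^ 2 := by
  rw [quadCost, quadCost]
  dsimp only
  set B := y.1 * Matrix.diagonal (y.2 : Fin (2 * m) → ℝ) * y.1ᵀ
  rw [lap_add, lap_smul, mul_add, Matrix.trace_add, Matrix.mul_smul, Matrix.trace_smul,
    trace_mul_lap P.K d, inner_add_left, real_inner_smul_left, ← sum_mul_adj, frobenius_sq,
    frobenius_sq]
  have h : ∑ i, ∑ j, (adj (w + s • d) - B) i j ^ 2 = ∑ i, ∑ j, (adj w - B) i j ^ 2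
      + 2 * s * ∑ i, ∑ j, (adj w - B) i j * adj d i j + s ^ 2 * (2 * ‖d‖ ^ 2) := by
    rw [← sum_adj_sq, adj_add, adj_smul]
    simp only [Finset.mul_sum, ← Finset.sum_add_distrib]
    refine Finset.sum_congr rfl fun i _ => Finset.sum_congr rfl fun j _ => ?_
    simp only [Matrix.sub_apply, Matrix.add_apply, Matrix.smul_apply, smul_eq_mul]
    ring
  rw [h, smul_eq_mul]
  ring

/-- The variational inequality of the projection onto the orthant, one coordinate at a time:
equality where nothing is clipped, and slack `L * (x.1 e * (h - x.1 e))` where the result is `0`. -/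
lemma inner_stepGrad_le (hγ : 0 < P.γ) (L₂ : ℝ≥0) {x : Var p m} (hx : ∀ e, 0 ≤ x.1 e) :
    inner ℝ (stepGrad P x) (wUpdate P L₂ x - x.1)
      ≤ -((2 + L₂ / P.γ) * ‖wUpdate P L₂ x - x.1‖ ^ 2) := by
  have hL : 0 < 2 + (L₂ : ℝ) / P.γ := by positivity
  set L := 2 + (L₂ : ℝ) / P.γ with hLdef
  rw [EuclideanSpace.norm_sq_eq, PiLp.inner_apply, Finset.mul_sum, ← Finset.sum_neg_distrib]
  refine Finset.sum_le_sum fun e _ => ?_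
  simp only [RCLike.inner_apply, conj_trivial, PiLp.sub_apply, wUpdate_apply, ← hLdef,
    Real.norm_eq_abs, sq_abs]
  set g := stepGrad P x e
  have hg : g = L * (1 / L * g) := by field_simp
  set h := 1 / L * g
  rw [hg]
  have h0 := hx e
  rcases le_total 0 (x.1 e - h) with h1 | h1
  · rw [max_eq_left h1]
    exact le_of_eq (by ring)
  · rw [max_eq_right h1]
    have : 0 ≤ L * (x.1 e * (h - x.1 e)) := by
      have : 0 ≤ h - x.1 e := by linarith
      positivity
    nlinarith

theorem cost_wUpdate_le (hγ : 0 < P.γ) {x₀ x : Var p m} {L₂ : ℝ≥0}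
    (hL₂ : LipschitzOnWith L₂ (gradient (negLogDet (p := p))) (Prod.fst '' levelSet P x₀))
    (hx : x ∈ levelSet P x₀) :
    0 < (lap (wUpdate P L₂ x) + J p).det ∧ cost P (wUpdate P L₂ x, x.2)
      ≤ cost P x - (2 * P.γ + L₂) / 2 * ‖wUpdate P L₂ x - x.1‖ ^ 2 := by
  obtain ⟨w, y⟩ := x
  obtain ⟨⟨hw, hdet, hV, hψ⟩, hc⟩ := hx
  dsimp only at hw hdet hV hψ ⊢
  set w' := wUpdate P L₂ (w, y) with hw'
  -- A zero step is treated apart, since `descent_on_segment` needs `0 < a`.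
  rcases eq_or_ne w' w with heq | hne
  · rw [heq]; simpa using hdet
  set d := w' - w with hd
  have hdn : 0 < ‖d‖ := norm_pos_iff.2 (sub_ne_zero.2 hne)
  have hγL : P.γ * (2 + L₂ / P.γ) = 2 * P.γ + L₂ := by field_simp
  have hline : ∀ s : ℝ, cost P (w + s • d, y) = negLogDet (w + s • d) + (quadCost P (w, y)
      + s * inner ℝ (lapStar P.K + P.γ • adjStar
      (adj w - y.1 * Matrix.diagonal (y.2 : Fin (2 * m) → ℝ) * y.1ᵀ)) d
      + P.γ * s ^ 2 * ‖d‖ ^ 2) := fun s => by rw [cost_eq, quadCost_line]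
  set g := lapStar P.K + P.γ • adjStar
      (adj w - y.1 * Matrix.diagonal (y.2 : Fin (2 * m) → ℝ) * y.1ᵀ) with hg
  have hcont : Continuous fun s : ℝ => w + s • d := by fun_prop
  have hnonneg : ∀ s ∈ Set.Icc (0 : ℝ) 1, ∀ e, 0 ≤ (w + s • d) e := by
    intro s hs e
    have h1 : 0 ≤ w' e := by rw [hw', wUpdate_apply]; exact le_max_right _ _
    have h2 : (w + s • d) e = (1 - s) * w e + s * w' e := by
      simp [hd]; ring
    rw [h2]
    exact add_nonneg (mul_nonneg (by linarith [hs.2]) (hw e)) (mul_nonneg hs.1 h1)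
  have key := descent_on_segment (f := fun s => cost P (w + s • d, y))
    (D := fun s => (lap (w + s • d) + J p).det)
    (f' := fun s => inner ℝ (gradient negLogDet (w + s • d)) d
      + (inner ℝ g d + P.γ * (2 * s) * ‖d‖ ^ 2))
    (a := (2 * P.γ + L₂) * ‖d‖ ^ 2) (by positivity) (continuous_det_lap hcont)
    ?_ (by simpa using hdet) ?_ ?_ ?_
  · have e1 : w + (1 : ℝ) • d = w' := by simp [hd]
    have e0 : w + (0 : ℝ) • d = w := by simp
    simp only [e1, e0] at key
    refine ⟨key.1, key.2.trans (le_of_eq (by ring))⟩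
  · have := (isClosed_cost_le P (m := m) (cost P (w + (0 : ℝ) • d, y))).preimage
      (hcont.prodMk (continuous_const (y := y)))
    exact this
  · intro s hs
    simp only [hline]
    have h0 : HasDerivAt (fun s : ℝ => w + s • d) d s := by
      simpa using ((hasDerivAt_id s).smul_const d).const_add w
    have h1 := (hasGradientAt_negLogDet hs)
    rw [h1.gradient]
    have h2 := h1.hasFDerivAt.comp_hasDerivAt s h0
    have h3 : HasDerivAt (fun s : ℝ => quadCost P (w, y) + s * inner ℝ g d
        + P.γ * s ^ 2 * ‖d‖ ^ 2) (inner ℝ g d + P.γ * (2 * s) * ‖d‖ ^ 2) s := by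
      refine ((((hasDerivAt_id' s).mul_const (inner ℝ g d)).const_add _).fun_add
        ((((hasDerivAt_id' s).fun_pow 2).const_mul P.γ).mul_const (‖d‖ ^ 2))).congr_deriv ?_
      push_cast
      ring
    exact h2.fun_add h3
  · have h1 := inner_stepGrad_le P hγ L₂ (x := (w, y)) hw
    rw [← hw'] at h1
    have h2 := mul_le_mul_of_nonneg_left h1 hγ.le
    rw [← real_inner_smul_left, smul_stepGrad P hγ] at h2
    simp only [zero_smul, add_zero, mul_zero, zero_mul, (hasGradientAt_negLogDet hdet).gradient]
    rw [← inner_add_left]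
    refine h2.trans (le_of_eq ?_)
    rw [← hγL]
    ring
  · intro s hs hDs hfs
    have hmem : ∀ u : ℝ, u ∈ Set.Icc (0 : ℝ) 1 → 0 < (lap (w + u • d) + J p).det →
        cost P (w + u • d, y) ≤ cost P (w, y) → w + u • d ∈ Prod.fst '' levelSet P x₀ :=
      fun u hu h1 h2 => ⟨(w + u • d, y), ⟨⟨hnonneg u hu, h1, hV, hψ⟩, h2.trans hc⟩, rfl⟩
    have hs' : w + s • d ∈ Prod.fst '' levelSet P x₀ := hmem s hs hDs (by simpa using hfs)
    have h0' : w ∈ Prod.fst '' levelSet P x₀ := by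
      simpa using hmem 0 (by simp) (by simpa using hdet) (by simp)
    have h1 := hL₂.dist_le_mul _ hs' _ h0'
    rw [dist_eq_norm, dist_eq_norm, add_sub_cancel_left, norm_smul, Real.norm_eq_abs,
      abs_of_nonneg hs.1] at h1
    have h2 := (real_inner_le_norm (gradient negLogDet (w + s • d) - gradient negLogDet w) d).trans
      (mul_le_mul_of_nonneg_right h1 (norm_nonneg d))
    rw [inner_sub_left] at h2
    simp only [zero_smul, add_zero]
    nlinarith

end Descent

/-! ### Order and sign pattern of the spectral set. -/

section Spectra

variable {m : ℕ} {c₁ c₂ : ℝ}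

lemma antitone_chain {x : Fin m → ℝ} (hx : x ∈ chainSet m c₁ c₂) :
    Antitone (Fin.cons (α := fun _ => ℝ) c₁ (Fin.snoc (α := fun _ => ℝ) x c₂)
      : Fin (m + 2) → ℝ) :=
  Fin.antitone_iff_succ_le.2 fun k => by
    have := hx k
    rw [chainGap] at this
    linarith

lemma antitone_of_mem_chainSet {x : Fin m → ℝ} (hx : x ∈ chainSet m c₁ c₂) : Antitone x := by
  intro i j hij
  have := antitone_chain hx (a := i.castSucc.succ) (b := j.castSucc.succ) (by simpa using hij)
  simpa only [Fin.cons_succ, Fin.snoc_castSucc] using this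

lemma le_of_mem_chainSet {x : Fin m → ℝ} (hx : x ∈ chainSet m c₁ c₂) (i : Fin m) : c₂ ≤ x i := by
  have := antitone_chain hx (a := i.castSucc.succ) (b := (Fin.last m).succ)
    (Fin.succ_le_succ_iff.2 (Fin.le_last _))
  simpa only [Fin.cons_succ, Fin.snoc_castSucc, Fin.snoc_last] using this

lemma le_of_mem_chainSet' {x : Fin m → ℝ} (hx : x ∈ chainSet m c₁ c₂) (i : Fin m) :
    x i ≤ c₁ := by
  have := antitone_chain hx (a := 0) (b := i.castSucc.succ) (Fin.zero_le _)
  simpa only [Fin.cons_succ, Fin.snoc_castSucc, Fin.cons_zero] using this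

lemma bijective_halves (m : ℕ) : Function.Bijective
    (Sum.elim (fun i : Fin m => halfIdx i) (fun i : Fin m => (halfIdx i).rev)) := by
  constructor
  · rintro (i | i) (j | j) h <;>
      simp only [Sum.elim_inl, Sum.elim_inr, halfIdx, Fin.ext_iff, Fin.val_rev,
        Fin.val_castLE, Sum.inl.injEq, Sum.inr.injEq, reduceCtorEq] at h ⊢ <;> omega
  · intro j
    by_cases hj : (j : ℕ) < m
    · exact ⟨Sum.inl ⟨j, hj⟩, by simp [halfIdx]⟩
    · refine ⟨Sum.inr ⟨2 * m - 1 - j, by omega⟩, ?_⟩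
      simp only [Sum.elim_inr, halfIdx, Fin.ext_iff, Fin.val_rev, Fin.val_castLE]
      omega

lemma forall_halves {C : Fin (2 * m) → Prop} (h₁ : ∀ i : Fin m, C (halfIdx i))
    (h₂ : ∀ i : Fin m, C (halfIdx i).rev) (j : Fin (2 * m)) : C j := by
  obtain ⟨i | i, rfl⟩ := (bijective_halves m).2 j
  exacts [h₁ i, h₂ i]

lemma sum_halves (f : Fin (2 * m) → ℝ) :
    ∑ j, f j = ∑ i : Fin m, (f (halfIdx i) + f (halfIdx i).rev) := by
  rw [Finset.sum_add_distrib, ← (bijective_halves m).sum_comp f, Fintype.sum_sum_type]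
  rfl

lemma apply_rev_of_mem {ψ : Spectra m} (hψ : ψ ∈ spectralSet m c₁ c₂) (i : Fin m) :
    ψ (halfIdx i).rev = - half ψ i := by
  have := hψ.1 i
  rw [half]; linarith

lemma sign_of_mem (hc₂ : 0 < c₂) {ψ : Spectra m} (hψ : ψ ∈ spectralSet m c₁ c₂)
    (j : Fin (2 * m)) : ((j : ℕ) < m → 0 ≤ ψ j) ∧ (m ≤ (j : ℕ) → ψ j ≤ 0) := by
  revert j
  refine forall_halves (fun i => ?_) (fun i => ?_)
  · have := le_of_mem_chainSet hψ.2 i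
    rw [half] at this
    refine ⟨fun _ => by linarith, fun h => ?_⟩
    simp [halfIdx] at h
    omega
  · have := le_of_mem_chainSet hψ.2 i
    rw [apply_rev_of_mem hψ]
    refine ⟨fun h => ?_, fun _ => by linarith⟩
    simp only [halfIdx, Fin.val_rev, Fin.val_castLE] at h
    omega

lemma antitone_of_mem_spectralSet (hc₂ : 0 < c₂) {ψ : Spectra m}
    (hψ : ψ ∈ spectralSet m c₁ c₂) : Antitone ψ := by
  have hanti := antitone_of_mem_chainSet hψ.2
  refine forall_halves (fun i => ?_) (fun i => ?_) <;>
    refine forall_halves (fun l => ?_) (fun l => ?_) <;> intro h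
  · change half ψ l ≤ half ψ i
    refine hanti (a := i) (b := l) ?_
    simp only [halfIdx, Fin.le_def, Fin.val_castLE] at h ⊢
    exact h
  · have h1 := le_of_mem_chainSet hψ.2 i
    have h2 := le_of_mem_chainSet hψ.2 l
    rw [apply_rev_of_mem hψ]
    change - half ψ l ≤ half ψ i
    linarith
  · simp only [halfIdx, Fin.le_def, Fin.val_rev, Fin.val_castLE] at h
    omega
  · rw [apply_rev_of_mem hψ, apply_rev_of_mem hψ]
    refine neg_le_neg (hanti (a := l) (b := i) ?_)
    simp only [halfIdx, Fin.le_def, Fin.val_rev, Fin.val_castLE] at h ⊢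
    omega

lemma abs_le_of_mem (hc₂ : 0 < c₂) {ψ : Spectra m} (hψ : ψ ∈ spectralSet m c₁ c₂)
    (j : Fin (2 * m)) : |ψ j| ≤ c₁ := by
  have key : ∀ i, |half ψ i| ≤ c₁ := fun i => by
    have h1 := le_of_mem_chainSet hψ.2 i
    rw [abs_of_pos (by linarith)]
    exact le_of_mem_chainSet' hψ.2 i
  revert j
  refine forall_halves key (fun i => ?_)
  rw [apply_rev_of_mem hψ, abs_neg]
  exact key i

end Spectra

/-! ### The trace inequality and the eigenvector update. -/

section KyFan

lemma sum_mul_eq_trace {n k : Type*} [Fintype n] [Fintype k] (A B : Matrix n k ℝ) :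
    ∑ i, ∑ j, A i j * B i j = (A * Bᵀ).trace := by
  simp [Matrix.trace, Matrix.mul_apply]

/-- For orthogonal `W`, the matrix of squared entries is doubly stochastic. -/
lemma sq_mem_doublyStochastic {n : Type*} [Fintype n] [DecidableEq n] {W : Matrix n n ℝ}
    (hW : Wᵀ * W = 1) : (Matrix.of fun i j => W i j ^ 2) ∈ doublyStochastic ℝ n := by
  have hW' : W * Wᵀ = 1 := mul_eq_one_comm.1 hW
  rw [mem_doublyStochastic_iff_sum]
  refine ⟨fun i j => sq_nonneg _, fun i => ?_, fun j => ?_⟩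
  · have := congr_fun (congr_fun hW' i) i
    simpa [Matrix.mul_apply, sq] using this
  · have := congr_fun (congr_fun hW j) j
    simpa [Matrix.mul_apply, sq] using this

/-- By Birkhoff's theorem `B` is a convex combination of permutation matrices, and for each of these
the bound is the rearrangement inequality. -/
lemma sum_mul_le_of_doublyStochastic {n : Type*} [Fintype n] [DecidableEq n] {B : Matrix n n ℝ}
    (hB : B ∈ doublyStochastic ℝ n) {f g : n → ℝ} (hfg : Monovary f g) :
    ∑ i, ∑ j, f i * B i j * g j ≤ ∑ i, f i * g i := by
  obtain ⟨c, hc0, hc1, rfl⟩ := exists_eq_sum_perm_of_mem_doublyStochastic hB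
  have h : ∑ i, ∑ j, f i * (∑ σ, c σ • Equiv.Perm.permMatrix ℝ σ) i j * g j
      = ∑ σ : Equiv.Perm n, c σ * ∑ i, f i * g (σ i) := by
    simp only [Matrix.sum_apply, Matrix.smul_apply, Finset.mul_sum, Finset.sum_mul]
    rw [Finset.sum_congr rfl fun i _ => Finset.sum_comm, Finset.sum_comm]
    refine Finset.sum_congr rfl fun σ _ => Finset.sum_congr rfl fun i _ => ?_
    rw [Finset.sum_eq_single (σ i)]
    · simp [Equiv.Perm.permMatrix, Equiv.toPEquiv, PEquiv.toMatrix_apply]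
      ring
    · intro j _ hj
      simp [Equiv.Perm.permMatrix, Equiv.toPEquiv, PEquiv.toMatrix_apply, hj.symm]
    · simp
  rw [h]
  calc _ ≤ ∑ σ : Equiv.Perm n, c σ * ∑ i, f i * g i :=
        Finset.sum_le_sum fun σ _ =>
          mul_le_mul_of_nonneg_left hfg.sum_mul_comp_perm_le_sum_mul (hc0 σ)
    _ = _ := by rw [← Finset.sum_mul, hc1, one_mul]

/-- The Ky Fan--von Neumann trace inequality for a diagonalized symmetric matrix. -/
lemma sum_mul_diag_le {n : Type*} [Fintype n] [DecidableEq n] {A Q U : Matrix n n ℝ} {d f : n → ℝ}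
    (hQ : Qᵀ * Q = 1) (hA : A * Q = Q * Matrix.diagonal d) (hU : Uᵀ * U = 1)
    (hdf : Monovary d f) : ∑ l, f l * (Uᵀ * A * U) l l ≤ ∑ l, f l * d l := by
  have hQ' : Q * Qᵀ = 1 := mul_eq_one_comm.1 hQ
  obtain ⟨W, hWdef⟩ : ∃ W, W = Qᵀ * U := ⟨_, rfl⟩
  have hW : Wᵀ * W = 1 := by
    rw [hWdef, Matrix.transpose_mul, Matrix.transpose_transpose, Matrix.mul_assoc,
      ← Matrix.mul_assoc Q, hQ', Matrix.one_mul, hU]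
  have hAeq : A = Q * Matrix.diagonal d * Qᵀ := by
    rw [← hA, Matrix.mul_assoc, hQ', Matrix.mul_one]
  have hform : Uᵀ * A * U = Wᵀ * Matrix.diagonal d * W := by
    rw [hAeq, hWdef, Matrix.transpose_mul, Matrix.transpose_transpose]
    simp only [Matrix.mul_assoc]
  have h := sum_mul_le_of_doublyStochastic (sq_mem_doublyStochastic hW) hdf
  rw [Finset.sum_comm] at h
  simp only [Matrix.of_apply] at h
  calc ∑ l, f l * (Uᵀ * A * U) l l
      = ∑ l, ∑ k, d k * W k l ^ 2 * f l := by
        refine Finset.sum_congr rfl fun l _ => ?_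
        rw [hform, Matrix.mul_apply, Finset.mul_sum]
        refine Finset.sum_congr rfl fun k _ => ?_
        rw [Matrix.mul_diagonal, Matrix.transpose_apply]
        ring
    _ ≤ ∑ l, d l * f l := h
    _ = ∑ l, f l * d l := Finset.sum_congr rfl fun l _ => mul_comm _ _

variable {p m z : ℕ} (hp : p = 2 * m + z)

lemma eigIdx_strictMono : StrictMono (eigIdx hp) := by
  intro i j h
  simp only [eigIdx, Fin.lt_def] at h ⊢
  split_ifs <;> omega

lemma mem_range_eigIdx {l : Fin p} (h : (l : ℕ) < m ∨ m + z ≤ (l : ℕ)) :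
    l ∈ Set.range (eigIdx hp) := by
  rcases h with h | h
  · exact ⟨⟨l, by omega⟩, by simp [eigIdx, h]⟩
  · refine ⟨⟨l - z, by omega⟩, ?_⟩
    simp only [eigIdx, Fin.ext_iff]
    split_ifs <;> omega

/-- The omitted positions are the middle ones, between the nonnegative and the nonpositive half, so
filling them with `0` keeps the order. This reduces the rectangular trace inequality to the square
one. -/
lemma antitone_extend {f : Fin (2 * m) → ℝ} (hf : Antitone f)
    (hs : ∀ j : Fin (2 * m), ((j : ℕ) < m → 0 ≤ f j) ∧ (m ≤ (j : ℕ) → f j ≤ 0)) :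
    Antitone (Function.extend (eigIdx hp) f 0) := by
  have hinj := (eigIdx_strictMono hp).injective
  intro k l hkl
  by_cases hk : k ∈ Set.range (eigIdx hp) <;> by_cases hl : l ∈ Set.range (eigIdx hp)
  · obtain ⟨a, rfl⟩ := hk
    obtain ⟨b, rfl⟩ := hl
    rw [hinj.extend_apply, hinj.extend_apply]
    exact hf ((eigIdx_strictMono hp).le_iff_le.1 hkl)
  · obtain ⟨a, rfl⟩ := hk
    rw [hinj.extend_apply, Function.extend_apply' _ _ _ hl]
    refine (hs a).1 ?_
    by_contra ha
    refine hl (mem_range_eigIdx hp (Or.inr ?_))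
    simp only [eigIdx, Fin.le_def, if_neg ha] at hkl
    omega
  · obtain ⟨b, rfl⟩ := hl
    rw [hinj.extend_apply, Function.extend_apply' _ _ _ hk]
    refine (hs b).2 ?_
    by_contra hb
    refine hk (mem_range_eigIdx hp (Or.inl ?_))
    simp only [eigIdx, Fin.le_def, if_pos (not_le.1 hb)] at hkl
    omega
  · rw [Function.extend_apply' _ _ _ hl, Function.extend_apply' _ _ _ hk]
    exact le_rfl

lemma exists_orthogonal_extension {V : Matrix (Fin p) (Fin (2 * m)) ℝ} (hV : Vᵀ * V = 1) :
    ∃ U : Matrix (Fin p) (Fin p) ℝ, Uᵀ * U = 1 ∧ ∀ i j, U i (eigIdx hp j) = V i j := by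
  have hinj := (eigIdx_strictMono hp).injective
  have hcol : ∀ j k, inner ℝ (WithLp.toLp 2 fun i => V i j : EuclideanSpace ℝ (Fin p))
      (WithLp.toLp 2 fun i => V i k) = if j = k then (1 : ℝ) else 0 := by
    intro j k
    have := congr_fun (congr_fun hV j) k
    rw [Matrix.one_apply] at this
    rw [← this, Matrix.mul_apply, PiLp.inner_apply]
    exact Finset.sum_congr rfl fun i _ => by simp [mul_comm]
  set v : Fin p → EuclideanSpace ℝ (Fin p) :=
    Function.extend (eigIdx hp) (fun j => WithLp.toLp 2 fun i => V i j) 0 with hv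
  have hvj : ∀ j, v (eigIdx hp j) = WithLp.toLp 2 fun i => V i j := fun j => by
    rw [hv, hinj.extend_apply]
  have hon : Orthonormal ℝ ((Set.range (eigIdx hp)).domRestrict v) := by
    rw [orthonormal_iff_ite]
    rintro ⟨k, hk⟩ ⟨l, hl⟩
    obtain ⟨j, rfl⟩ := Set.mem_range.1 hk
    obtain ⟨k, rfl⟩ := Set.mem_range.1 hl
    simp only [Set.domRestrict_apply, hvj, hcol, Subtype.mk.injEq, hinj.eq_iff]
  obtain ⟨b, hb⟩ := hon.exists_orthonormalBasis_extension_of_card_eq (by simp)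
  refine ⟨Matrix.of fun i l => b l i, ?_, fun i j => ?_⟩
  · ext k l
    have := orthonormal_iff_ite.1 b.orthonormal k l
    rw [PiLp.inner_apply] at this
    rw [Matrix.one_apply, ← this, Matrix.mul_apply]
    exact Finset.sum_congr rfl fun i _ => by simp [mul_comm]
  · rw [Matrix.of_apply, hb _ ⟨j, rfl⟩, hvj]

variable {hp}

lemma IsEigUpdate.transpose_mul_self {A : Matrix (Fin p) (Fin p) ℝ}
    {V : Matrix (Fin p) (Fin (2 * m)) ℝ} (h : IsEigUpdate hp A V) : Vᵀ * V = 1 := by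
  obtain ⟨Q, d, hQ, -, -, hV⟩ := h
  ext j k
  have := congr_fun (congr_fun hQ (eigIdx hp j)) (eigIdx hp k)
  simpa [Matrix.mul_apply, hV, Matrix.one_apply, (eigIdx_strictMono hp).injective.eq_iff]
    using this

/-- Writing the eigenvalues as Rayleigh quotients makes this an equation in `A` and `V` alone, which
passes to limits. -/
lemma IsEigUpdate.exists_eigenvalues {A : Matrix (Fin p) (Fin p) ℝ}
    {V : Matrix (Fin p) (Fin (2 * m)) ℝ} (h : IsEigUpdate hp A V) :
    A * V = V * Matrix.diagonal fun j => (Vᵀ * A * V) j j := by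
  have hVV := h.transpose_mul_self
  obtain ⟨Q, d, hQ, -, hA, hV⟩ := h
  have hAV : A * V = V * Matrix.diagonal fun j => d (eigIdx hp j) := by
    ext i j
    have := congr_fun (congr_fun hA i) (eigIdx hp j)
    rw [Matrix.mul_diagonal] at this ⊢
    simpa [Matrix.mul_apply, hV] using this
  rw [Matrix.mul_assoc, hAV, ← Matrix.mul_assoc, hVV, Matrix.one_mul]
  simp

lemma IsEigUpdate.sum_mul_diag_le {A : Matrix (Fin p) (Fin p) ℝ}
    {V U : Matrix (Fin p) (Fin (2 * m)) ℝ} (h : IsEigUpdate hp A V) (hU : Uᵀ * U = 1)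
    {f : Fin (2 * m) → ℝ} (hf : Antitone f)
    (hs : ∀ j : Fin (2 * m), ((j : ℕ) < m → 0 ≤ f j) ∧ (m ≤ (j : ℕ) → f j ≤ 0)) :
    ∑ j, f j * (Uᵀ * A * U) j j ≤ ∑ j, f j * (Vᵀ * A * V) j j := by
  have hinj := (eigIdx_strictMono hp).injective
  obtain ⟨Q, d, hQ, hd, hA, hV⟩ := h
  obtain ⟨U', hU', hUU'⟩ := exists_orthogonal_extension hp hU
  have hsum : ∀ (g : Fin p → ℝ) (g' : Fin (2 * m) → ℝ), (∀ j, g' j = g (eigIdx hp j)) →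
      ∑ j, f j * g' j = ∑ l, Function.extend (eigIdx hp) f 0 l * g l := by
    intro g g' hg
    refine Fintype.sum_of_injective _ hinj _ _ (fun l hl => ?_) (fun j => ?_)
    · rw [Function.extend_apply' _ _ _ hl]; simp
    · rw [hinj.extend_apply, hg]
  rw [hsum (fun l => (U'ᵀ * A * U') l l) _ fun j => by simp [Matrix.mul_apply, hUU'],
    hsum (fun l => (Qᵀ * A * Q) l l) _ fun j => by simp [Matrix.mul_apply, hV]]
  have hQA : Qᵀ * A * Q = Matrix.diagonal d := by
    rw [Matrix.mul_assoc, hA, ← Matrix.mul_assoc, hQ, Matrix.one_mul]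
  rw [hQA]
  simp only [Matrix.diagonal_apply_eq]
  exact SGA.sum_mul_diag_le hQ hA hU' (hd.monovary (antitone_extend hp hf hs))

end KyFan

/-! ### Optimality of the `V`- and `ψ`-updates. -/

section BlockUpdates

variable {p m : ℕ}

/-- Only the middle term depends on `U`, so minimizing over `V` amounts to maximizing a weighted
trace. -/
lemma norm_sub_sq_eq {A : Matrix (Fin p) (Fin p) ℝ} {U : Matrix (Fin p) (Fin (2 * m)) ℝ}
    (hU : Uᵀ * U = 1) (f : Fin (2 * m) → ℝ) :
    ‖A - U * Matrix.diagonal f * Uᵀ‖ ^ 2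
      = ‖A‖ ^ 2 - 2 * ∑ j, f j * (Uᵀ * A * U) j j + ∑ j, f j ^ 2 := by
  set B := U * Matrix.diagonal f * Uᵀ with hB
  have hBt : Bᵀ = B := by
    rw [hB, Matrix.transpose_mul, Matrix.transpose_mul, Matrix.transpose_transpose,
      Matrix.diagonal_transpose, Matrix.mul_assoc]
  have h1 : ∑ i, ∑ j, A i j * B i j = ∑ j, f j * (Uᵀ * A * U) j j := by
    rw [sum_mul_eq_trace, hBt, hB, ← Matrix.mul_assoc, ← Matrix.mul_assoc, Matrix.trace_mul_comm,
      ← Matrix.mul_assoc, ← Matrix.mul_assoc, Matrix.trace]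
    refine Finset.sum_congr rfl fun j _ => ?_
    rw [Matrix.diag_apply, Matrix.mul_diagonal, mul_comm]
  have h2 : ∑ i, ∑ j, B i j * B i j = ∑ j, f j ^ 2 := by
    rw [sum_mul_eq_trace, hBt, hB, ← Matrix.mul_assoc, ← Matrix.mul_assoc, Matrix.trace_mul_comm]
    simp only [← Matrix.mul_assoc]
    rw [hU, Matrix.one_mul, Matrix.mul_assoc (Matrix.diagonal f), hU, Matrix.mul_one,
      Matrix.diagonal_mul_diagonal, Matrix.trace_diagonal]
    exact Finset.sum_congr rfl fun j _ => (sq _).symm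
  rw [frobenius_sq, frobenius_sq, ← h1, ← h2]
  simp only [Finset.mul_sum, ← Finset.sum_sub_distrib, ← Finset.sum_add_distrib]
  refine Finset.sum_congr rfl fun i _ => Finset.sum_congr rfl fun j _ => ?_
  rw [Matrix.sub_apply]
  ring

variable {P : Params p}

lemma IsEigUpdate.cost_le {z : ℕ} {hp : p = 2 * m + z} (hγ : 0 < P.γ) (hc₂ : 0 < P.c₂)
    {w : Weights p} {V U : Matrix (Fin p) (Fin (2 * m)) ℝ} (h : IsEigUpdate hp (adj w) V)
    (hU : Uᵀ * U = 1) {ψ : Spectra m} (hψ : ψ ∈ spectralSet m P.c₁ P.c₂) :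
    cost P (w, V, ψ) ≤ cost P (w, U, ψ) := by
  have key := h.sum_mul_diag_le hU (antitone_of_mem_spectralSet hc₂ hψ) (sign_of_mem hc₂ hψ)
  rw [cost, cost]
  dsimp only
  rw [norm_sub_sq_eq hU, norm_sub_sq_eq h.transpose_mul_self]
  gcongr

lemma IsPsiUpdate.mem {w : Weights p} {V : Matrix (Fin p) (Fin (2 * m)) ℝ} {ψ : Spectra m}
    (h : IsPsiUpdate P w V ψ) : ψ ∈ spectralSet m P.c₁ P.c₂ :=
  ⟨fun i => by rw [h.2.2 i, neg_neg], h.1⟩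

lemma IsPsiUpdate.cost_le (hγ : 0 < P.γ) {w : Weights p} {V : Matrix (Fin p) (Fin (2 * m)) ℝ}
    (hV : Vᵀ * V = 1) {ψ φ : Spectra m} (h : IsPsiUpdate P w V ψ)
    (hφ : φ ∈ spectralSet m P.c₁ P.c₂) : cost P (w, V, ψ) ≤ cost P (w, V, φ) := by
  have hmin : ∑ i, (half ψ i - ((Vᵀ * adj w * V) (halfIdx i) (halfIdx i)
      - (Vᵀ * adj w * V) (halfIdx i).rev (halfIdx i).rev) / 2) ^ 2
      ≤ ∑ i, (half φ i - ((Vᵀ * adj w * V) (halfIdx i) (halfIdx i)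
      - (Vᵀ * adj w * V) (halfIdx i).rev (halfIdx i).rev) / 2) ^ 2 := h.2.1 hφ.2
  -- Pairing each position with its mirror image and completing the square: up to a constant, the
  -- penalty is twice the squared distance to `ẽ`.
  have hsum : ∀ θ : Spectra m, θ ∈ spectralSet m P.c₁ P.c₂ →
      - 2 * ∑ j, θ j * (Vᵀ * adj w * V) j j + ∑ j, θ j ^ 2
        = 2 * ∑ i, (half θ i - ((Vᵀ * adj w * V) (halfIdx i) (halfIdx i)
          - (Vᵀ * adj w * V) (halfIdx i).rev (halfIdx i).rev) / 2) ^ 2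
          - 2 * ∑ i : Fin m, (((Vᵀ * adj w * V) (halfIdx i) (halfIdx i)
          - (Vᵀ * adj w * V) (halfIdx i).rev (halfIdx i).rev) / 2) ^ 2 := by
    intro θ hθ
    rw [sum_halves, sum_halves]
    simp only [Finset.mul_sum, ← Finset.sum_sub_distrib, ← Finset.sum_add_distrib]
    refine Finset.sum_congr rfl fun i _ => ?_
    rw [apply_rev_of_mem hθ]
    change - 2 * (half θ i * _ + _) + _ = _
    rw [show θ (halfIdx i) = half θ i from rfl]
    ring
  have h1 := hsum ψ h.mem
  have h2 := hsum φ hφ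
  rw [cost, cost]
  dsimp only
  rw [norm_sub_sq_eq hV, norm_sub_sq_eq hV]
  gcongr 1
  refine mul_le_mul_of_nonneg_left ?_ (by positivity)
  linarith

end BlockUpdates

/-! ### Multipliers of the chain constraint. -/

section Chain

variable {m : ℕ}

lemma forall_chain {C : Fin (m + 2) → Prop} (h₀ : C 0) (h₁ : ∀ i : Fin m, C i.castSucc.succ)
    (h₂ : C (Fin.last m).succ) (k : Fin (m + 2)) : C k :=
  Fin.cases h₀ (fun j => Fin.lastCases h₂ h₁ j) k

lemma differentiable_chainGap (c₁ c₂ : ℝ) (k : Fin (m + 1)) :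
    Differentiable ℝ fun x : Fin m → ℝ => chainGap c₁ c₂ x k := by
  have h : ∀ j : Fin (m + 2), Differentiable ℝ fun x : Fin m → ℝ =>
      (Fin.cons (α := fun _ => ℝ) c₁ (Fin.snoc (α := fun _ => ℝ) x c₂) : Fin (m + 2) → ℝ) j := by
    refine forall_chain ?_ (fun i => ?_) ?_
    · simp only [Fin.cons_zero]; fun_prop
    · simp only [Fin.cons_succ, Fin.snoc_castSucc]; fun_prop
    · simp only [Fin.cons_succ, Fin.snoc_last]; fun_prop
  exact (h k.castSucc).sub (h k.succ)

lemma chainGap_line (c₁ c₂ : ℝ) (x v : Fin m → ℝ) (s : ℝ) (k : Fin (m + 1)) :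
    chainGap c₁ c₂ (x + s • v) k = chainGap c₁ c₂ x k + s * chainGap 0 0 v k := by
  have h : ∀ j : Fin (m + 2),
      (Fin.cons (α := fun _ => ℝ) c₁ (Fin.snoc (α := fun _ => ℝ) (x + s • v) c₂)
        : Fin (m + 2) → ℝ) j
      = (Fin.cons (α := fun _ => ℝ) c₁ (Fin.snoc (α := fun _ => ℝ) x c₂) : Fin (m + 2) → ℝ) j
        + s * (Fin.cons (α := fun _ => ℝ) 0 (Fin.snoc (α := fun _ => ℝ) v 0)
          : Fin (m + 2) → ℝ) j := by
    refine forall_chain ?_ (fun i => ?_) ?_ <;> simp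
  simp only [chainGap, h]
  ring

/-- Summation by parts, with no boundary terms because the chain ends in zeros. -/
lemma sum_mul_chainGap (G : Fin (m + 1) → ℝ) (v : Fin m → ℝ) :
    ∑ k, G k * chainGap 0 0 v k = ∑ i, v i * (G i.succ - G i.castSucc) := by
  simp only [chainGap, mul_sub, Finset.sum_sub_distrib]
  rw [Fin.sum_univ_succ, Fin.sum_univ_castSucc (n := m)]
  simp only [← Fin.succ_castSucc, Fin.castSucc_zero, Fin.cons_zero, Fin.cons_succ,
    Fin.snoc_castSucc, Fin.snoc_last, mul_zero, zero_add, add_zero]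
  congr 1 <;> exact Finset.sum_congr rfl fun i _ => mul_comm _ _

/-- A direction that moves length from the gap `k` to the gap `l`. -/
lemma exists_chainGap_exchange (k l : Fin (m + 1)) : ∃ v : Fin m → ℝ, ∀ j,
    chainGap 0 0 v j = (if j = l then 1 else 0) - (if j = k then 1 else 0) := by
  refine ⟨fun i => (if k < i.succ then 1 else 0) - (if l < i.succ then 1 else 0), fun j => ?_⟩
  have h : ∀ j : Fin (m + 2), (Fin.cons (α := fun _ => ℝ) 0 (Fin.snoc (α := fun _ => ℝ)
      (fun i : Fin m => ((if k < i.succ then 1 else 0) - (if l < i.succ then 1 else 0) : ℝ)) 0)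
        : Fin (m + 2) → ℝ) j
      = (if (k : ℕ) < j then 1 else 0) - (if (l : ℕ) < j then 1 else 0) := by
    refine forall_chain ?_ (fun i => ?_) ?_
    · simp
    · simp [Fin.lt_def]
    · simp [k.isLt, l.isLt]
  simp only [chainGap, h, Fin.val_castSucc, Fin.val_succ, Fin.ext_iff]
  split_ifs <;> first | omega | norm_num

/-- Multipliers of the chain constraint at a metric projection. -/
lemma exists_chain_multipliers {c₁ c₂ : ℝ} {x a : Fin m → ℝ} (hx : x ∈ chainSet m c₁ c₂)
    (hmin : IsMinOn (fun y : Fin m → ℝ => ∑ i, (y i - a i) ^ 2) (chainSet m c₁ c₂) x)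
    {c : ℝ} (hc : 0 ≤ c) : ∃ μ : Fin (m + 1) → ℝ, (∀ k, 0 ≤ μ k) ∧
      (∀ k, μ k * chainGap c₁ c₂ x k = 0) ∧
      ∀ i : Fin m, μ i.succ - μ i.castSucc = c * (x i - a i) := by
  -- The required differences determine the multipliers up to a constant; subtracting the minimum `G
  -- l` makes them nonnegative.
  set G : Fin (m + 1) → ℝ := Fin.partialSum fun i => c * (x i - a i) with hG
  have hGi : ∀ i : Fin m, G i.succ - G i.castSucc = c * (x i - a i) := fun i => by
    rw [hG, Fin.partialSum_succ]; ring
  obtain ⟨l, hl⟩ := Finite.exists_min G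
  refine ⟨fun k => G k - G l, fun k => sub_nonneg.2 (hl k), fun k => ?_, fun i => ?_⟩
  · rcases (hx k).eq_or_lt with h | h
    · rw [← h, mul_zero]
    -- If the gap `k` is open, moving length from it to the gap `l` is feasible, so the first
    -- variation `G l - G k` is nonnegative.
    suffices hle : G k ≤ G l from mul_eq_zero_of_left (sub_eq_zero.2 (le_antisymm hle (hl k))) _
    obtain ⟨v, hv⟩ := exists_chainGap_exchange k l
    have hexp : ∀ s : ℝ, ∑ i, ((x + s • v) i - a i) ^ 2 = ∑ i, (x i - a i) ^ 2
        + s * (2 * ∑ i, v i * (x i - a i)) + s ^ 2 * ∑ i, v i ^ 2 := by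
      intro s
      simp only [Finset.mul_sum, ← Finset.sum_add_distrib]
      refine Finset.sum_congr rfl fun i _ => ?_
      simp only [Pi.add_apply, Pi.smul_apply, smul_eq_mul]
      ring
    have hnonneg : 0 ≤ ∑ i, v i * (x i - a i) := by
      by_contra hneg
      push Not at hneg
      set T := ∑ i, v i * (x i - a i)
      set N := ∑ i, v i ^ 2
      have hN : 0 ≤ N := Finset.sum_nonneg fun i _ => sq_nonneg _
      -- The first bound keeps the gap `k` nonnegative, the second lets the linear term `2 * s * T`
      -- dominate `s ^ 2 * N`.
      obtain ⟨s, hs0, hs1, hs2⟩ : ∃ s : ℝ, 0 < s ∧ s ≤ chainGap c₁ c₂ x k ∧ s * (N + 1) ≤ -T := by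
        refine ⟨min (chainGap c₁ c₂ x k) (-T / (N + 1)), lt_min h (by
          apply div_pos <;> linarith), min_le_left _ _, ?_⟩
        rw [← le_div_iff₀ (by linarith)]
        exact min_le_right _ _
      have hmem : x + s • v ∈ chainSet m c₁ c₂ := by
        intro j
        rw [chainGap_line, hv]
        have hj := hx j
        by_cases hjk : j = k
        · subst hjk
          split_ifs <;> nlinarith
        · rw [if_neg hjk]
          split_ifs <;> nlinarith
      have := hmin hmem
      simp only [Set.mem_ofPred_eq, hexp] at this
      nlinarith
    have h1 := sum_mul_chainGap G v
    simp only [hv, hGi, mul_sub, mul_ite, mul_one, mul_zero, Finset.sum_sub_distrib,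
      Finset.sum_ite_eq', Finset.mem_univ, if_true] at h1
    have h2 : ∑ i, v i * (c * x i) - ∑ i, v i * (c * a i) = c * ∑ i, v i * (x i - a i) := by
      rw [Finset.mul_sum, ← Finset.sum_sub_distrib]
      exact Finset.sum_congr rfl fun i _ => by ring
    have := mul_nonneg hc hnonneg
    linarith
  · rw [← hGi]; ring

end Chain

/-! ### Stationarity of the Lagrangian, block by block. -/

section Stationarity

variable {p m : ℕ} {P : Params p}

lemma differentiableAt_lagrangian (μ₁ : Edge p → ℝ) (μ₂ : Fin (m + 1) → ℝ) (ν : Fin m → ℝ)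
    (M : Matrix (Fin (2 * m)) (Fin (2 * m)) ℝ) {x : Var p m} (hx : 0 < (lap x.1 + J p).det) :
    DifferentiableAt ℝ (lagrangian P μ₁ μ₂ ν M) x := by
  have h1 : DifferentiableAt ℝ (cost P (m := m)) x := by
    rw [show cost P (m := m) = _ from funext (cost_eq P)]
    exact ((differentiableAt_negLogDet hx.ne').comp x differentiableAt_fst).add
      (differentiable_quadCost P x)
  have h2 : Differentiable ℝ fun x : Var p m => ∑ e, μ₁ e * x.1 e := by fun_prop
  have h3 : Differentiable ℝ fun x : Var p m =>
      ∑ k, μ₂ k * chainGap P.c₁ P.c₂ (half x.2.2) k := by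
    have : Differentiable ℝ fun x : Var p m => half x.2.2 :=
      differentiable_pi.2 fun i => by unfold half; fun_prop
    exact Differentiable.fun_sum fun k _ =>
      ((differentiable_chainGap P.c₁ P.c₂ k).comp this).const_mul _
  have h4 : Differentiable ℝ fun x : Var p m =>
      ∑ i, ν i * (x.2.2 (halfIdx i) + x.2.2 (halfIdx i).rev) := by fun_prop
  have h5 : Differentiable ℝ fun x : Var p m => (Mᵀ * (x.2.1ᵀ * x.2.1 - 1)).trace := by
    simp only [Matrix.trace, Matrix.diag_apply, Matrix.mul_apply, Matrix.transpose_apply,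
      Matrix.sub_apply]
    fun_prop
  exact (((h1.sub (h2 x)).sub (h3 x)).add (h4 x)).add (h5 x)

lemma fderiv_apply_eq {E : Type*} [NormedAddCommGroup E] [NormedSpace ℝ E] {f : E → ℝ} {x v : E}
    {a : ℝ} (hf : DifferentiableAt ℝ f x) (h : HasDerivAt (fun s : ℝ => f (x + s • v)) a 0) :
    fderiv ℝ f x v = a := by
  have h0 : HasDerivAt (fun s : ℝ => x + s • v) v 0 := by
    simpa using ((hasDerivAt_id (0 : ℝ)).smul_const v).const_add x
  have h2 : HasFDerivAt f (fderiv ℝ f x) (x + (0 : ℝ) • v) := by simpa using hf.hasFDerivAt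
  exact (h2.comp_hasDerivAt 0 h0).unique h

lemma hasFDerivAt_zero_of_blocks {E F G : Type*} [NormedAddCommGroup E] [NormedSpace ℝ E]
    [NormedAddCommGroup F] [NormedSpace ℝ F] [NormedAddCommGroup G] [NormedSpace ℝ G]
    {f : E × F × G → ℝ} {x : E × F × G} (hf : DifferentiableAt ℝ f x)
    (h₁ : ∀ u : E, HasDerivAt (fun s : ℝ => f (x + s • (u, 0, 0))) 0 0)
    (h₂ : ∀ v : F, HasDerivAt (fun s : ℝ => f (x + s • (0, v, 0))) 0 0)
    (h₃ : ∀ y : G, HasDerivAt (fun s : ℝ => f (x + s • (0, 0, y))) 0 0) :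
    HasFDerivAt f (0 : E × F × G →L[ℝ] ℝ) x := by
  refine hf.hasFDerivAt.congr_fderiv (ContinuousLinearMap.ext fun ⟨u, v, y⟩ => ?_)
  rw [show (u, v, y) = (u, 0, 0) + (0, v, 0) + (0, 0, y) by simp, map_add, map_add,
    fderiv_apply_eq hf (h₁ u), fderiv_apply_eq hf (h₂ v), fderiv_apply_eq hf (h₃ y)]
  simp

/-- Along a line in one block, everything except the log-determinant is a polynomial of degree at
most four, the degree of the penalty in `V`. -/
lemma hasDerivAt_poly (c₀ c₁ c₂ c₃ c₄ : ℝ) :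
    HasDerivAt (fun s : ℝ => c₀ + s * c₁ + s ^ 2 * c₂ + s ^ 3 * c₃ + s ^ 4 * c₄) c₁ 0 := by
  have h := hasDerivAt_id' (0 : ℝ)
  refine (((((h.mul_const c₁).const_add c₀).fun_add ((h.fun_pow 2).mul_const c₂)).fun_add
    ((h.fun_pow 3).mul_const c₃)).fun_add ((h.fun_pow 4).mul_const c₄)).congr_deriv ?_
  norm_num

variable (μ₁ : Edge p → ℝ) (μ₂ : Fin (m + 1) → ℝ) (ν : Fin m → ℝ)

lemma hasDerivAt_lagrangian_fst (hγ : 0 < P.γ) (M : Matrix (Fin (2 * m)) (Fin (2 * m)) ℝ)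
    {x : Var p m} (hx : 0 < (lap x.1 + J p).det) (hμ : ∀ e, μ₁ e = P.γ * stepGrad P x e)
    (u : Weights p) :
    HasDerivAt (fun s : ℝ => lagrangian P μ₁ μ₂ ν M (x + s • ((u, 0, 0) : Var p m))) 0 0 := by
  obtain ⟨w, V, ψ⟩ := x
  have hg := smul_stepGrad P hγ (w, V, ψ)
  set g := lapStar P.K + P.γ • adjStar
      (adj w - V * Matrix.diagonal (ψ : Fin (2 * m) → ℝ) * Vᵀ) with hgdef
  have hline : ∀ s : ℝ, (w, V, ψ) + s • ((u, 0, 0) : Var p m) = (w + s • u, V, ψ) := fun s => by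
    simp
  have h1 : HasDerivAt (fun s : ℝ => negLogDet (w + s • u))
      (inner ℝ (- lapStar (lap w + J p)⁻¹) u) 0 := by
    have h0 : HasDerivAt (fun s : ℝ => w + s • u) u 0 := by
      simpa using ((hasDerivAt_id (0 : ℝ)).smul_const u).const_add w
    have h2 := (hasGradientAt_negLogDet (w := w + (0 : ℝ) • u) (by simpa using hx)).hasFDerivAt
    refine (h2.comp_hasDerivAt 0 h0).congr_deriv ?_
    simp
  have h2 := hasDerivAt_poly (quadCost P (w, V, ψ) - ∑ e, μ₁ e * w e
    - ∑ k, μ₂ k * chainGap P.c₁ P.c₂ (half ψ) k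
    + ∑ i, ν i * (ψ (halfIdx i) + ψ (halfIdx i).rev) + (Mᵀ * (Vᵀ * V - 1)).trace)
    (inner ℝ g u - ∑ e, μ₁ e * u e) (P.γ * ‖u‖ ^ 2) 0 0
  have h3 : ∑ e, μ₁ e * u e = inner ℝ (P.γ • stepGrad P (w, V, ψ)) u := by
    rw [PiLp.inner_apply]
    refine Finset.sum_congr rfl fun e _ => ?_
    rw [hμ]
    simp [mul_comm]
  refine (h1.fun_add h2).congr_deriv ?_ |>.congr_of_eventuallyEq (Eventually.of_forall fun s => ?_)
  · rw [h3, hg, inner_add_left (- _) g]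
    ring
  · dsimp only
    rw [hline, lagrangian, cost_eq]
    dsimp only
    rw [quadCost_line]
    simp only [PiLp.add_apply, PiLp.smul_apply, smul_eq_mul, mul_add, Finset.sum_add_distrib,
      mul_left_comm _ s, ← Finset.mul_sum]
    rw [← hgdef]
    ring

lemma hasDerivAt_lagrangian_snd {M : Matrix (Fin (2 * m)) (Fin (2 * m)) ℝ} {x : Var p m}
    (hMt : Mᵀ = M)
    (hM : P.γ • ((adj x.1 - x.2.1 * Matrix.diagonal (x.2.2 : Fin (2 * m) → ℝ) * x.2.1ᵀ) * x.2.1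
      * Matrix.diagonal (x.2.2 : Fin (2 * m) → ℝ)) = x.2.1 * M)
    (Z : Matrix (Fin p) (Fin (2 * m)) ℝ) :
    HasDerivAt (fun s : ℝ => lagrangian P μ₁ μ₂ ν M (x + s • ((0, Z, 0) : Var p m))) 0 0 := by
  obtain ⟨w, V, ψ⟩ := x
  dsimp only at hM
  set Ψ := Matrix.diagonal (ψ : Fin (2 * m) → ℝ) with hΨ
  have hΨt : Ψᵀ = Ψ := Matrix.diagonal_transpose _
  set R := adj w - V * Ψ * Vᵀ with hR
  set C := Z * Ψ * Vᵀ + V * Ψ * Zᵀ with hC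
  set D := Z * Ψ * Zᵀ with hD
  have hRt : Rᵀ = R := by
    rw [hR, Matrix.transpose_sub, adj_transpose, Matrix.transpose_mul, Matrix.transpose_mul, hΨt,
      Matrix.transpose_transpose, Matrix.mul_assoc]
  have hCt : Cᵀ = C := by
    rw [hC]
    simp only [Matrix.transpose_add, Matrix.transpose_mul, hΨt, Matrix.transpose_transpose,
      Matrix.mul_assoc]
    rw [add_comm]
  have hline : ∀ s : ℝ, (w, V, ψ) + s • ((0, Z, 0) : Var p m) = (w, V + s • Z, ψ) := fun s => by
    simp
  have hRs : ∀ s : ℝ, adj w - (V + s • Z) * Ψ * (V + s • Z)ᵀ = R - s • C - s ^ 2 • D := by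
    intro s
    rw [hR, hC, hD]
    simp only [Matrix.transpose_add, Matrix.transpose_smul, Matrix.add_mul, Matrix.mul_add,
      Matrix.smul_mul, Matrix.mul_smul, smul_add, smul_smul, sq]
    abel
  have hnorm : ∀ s : ℝ, ‖R - s • C - s ^ 2 • D‖ ^ 2 = ∑ i, ∑ j, R i j ^ 2
      + s * (- 2 * ∑ i, ∑ j, R i j * C i j)
      + s ^ 2 * (∑ i, ∑ j, (C i j ^ 2 - 2 * (R i j * D i j)))
      + s ^ 3 * (2 * ∑ i, ∑ j, C i j * D i j) + s ^ 4 * ∑ i, ∑ j, D i j ^ 2 := by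
    intro s
    rw [frobenius_sq]
    simp only [Finset.mul_sum, ← Finset.sum_add_distrib]
    refine Finset.sum_congr rfl fun i _ => Finset.sum_congr rfl fun j _ => ?_
    simp only [Matrix.sub_apply, Matrix.smul_apply, smul_eq_mul]
    ring
  have htr : ∀ s : ℝ, (Mᵀ * ((V + s • Z)ᵀ * (V + s • Z) - 1)).trace
      = (Mᵀ * (Vᵀ * V - 1)).trace + s * (Mᵀ * (Zᵀ * V + Vᵀ * Z)).trace
        + s ^ 2 * (Mᵀ * (Zᵀ * Z)).trace := by
    intro s
    rw [← smul_eq_mul s, ← smul_eq_mul (s ^ 2), ← Matrix.trace_smul, ← Matrix.trace_smul,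
      ← Matrix.trace_add, ← Matrix.trace_add]
    congr 1
    simp only [Matrix.transpose_add, Matrix.transpose_smul, Matrix.add_mul, Matrix.mul_add,
      Matrix.smul_mul, Matrix.mul_smul, smul_add, smul_smul, sq, Matrix.mul_sub]
    abel
  -- By symmetry of `R` and `M` the two parts are `-2γ tr (R V Ψ Zᵀ)` and `2 tr (M Zᵀ V)`, which
  -- `hM` makes cancel.
  have hlin : P.γ / 2 * (- 2 * ∑ i, ∑ j, R i j * C i j)
      + (Mᵀ * (Zᵀ * V + Vᵀ * Z)).trace = 0 := by
    have e1 : (R * (Z * Ψ * Vᵀ)).trace = (R * (V * Ψ * Zᵀ)).trace := by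
      rw [← Matrix.trace_transpose, Matrix.transpose_mul, Matrix.transpose_mul,
        Matrix.transpose_mul, Matrix.transpose_transpose, hΨt, hRt, Matrix.trace_mul_comm,
        Matrix.mul_assoc V]
    have e2 : (M * (Vᵀ * Z)).trace = (M * (Zᵀ * V)).trace := by
      rw [← Matrix.trace_transpose, Matrix.transpose_mul, Matrix.transpose_mul,
        Matrix.transpose_transpose, hMt, Matrix.trace_mul_comm]
    have e3 : P.γ * (R * (V * Ψ * Zᵀ)).trace = (M * (Zᵀ * V)).trace := by
      rw [← Matrix.mul_assoc, ← Matrix.mul_assoc, ← smul_eq_mul, ← Matrix.trace_smul,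
        ← Matrix.smul_mul, hM, ← Matrix.mul_assoc, Matrix.trace_mul_comm (M * Zᵀ),
        ← Matrix.mul_assoc]
    rw [sum_mul_eq_trace, hCt, hC, Matrix.mul_add, Matrix.trace_add, e1, hMt, Matrix.mul_add,
      Matrix.trace_add, e2, ← e3]
    ring
  refine (hasDerivAt_poly (negLogDet w + (P.K * lap w).trace + P.γ / 2 * ∑ i, ∑ j, R i j ^ 2
    - ∑ e, μ₁ e * w e - ∑ k, μ₂ k * chainGap P.c₁ P.c₂ (half ψ) k
    + ∑ i, ν i * (ψ (halfIdx i) + ψ (halfIdx i).rev) + (Mᵀ * (Vᵀ * V - 1)).trace)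
    (P.γ / 2 * (- 2 * ∑ i, ∑ j, R i j * C i j) + (Mᵀ * (Zᵀ * V + Vᵀ * Z)).trace)
    (P.γ / 2 * (∑ i, ∑ j, (C i j ^ 2 - 2 * (R i j * D i j))) + (Mᵀ * (Zᵀ * Z)).trace)
    (P.γ / 2 * (2 * ∑ i, ∑ j, C i j * D i j))
    (P.γ / 2 * ∑ i, ∑ j, D i j ^ 2)).congr_deriv hlin
    |>.congr_of_eventuallyEq (Eventually.of_forall fun s => ?_)
  dsimp only
  rw [hline, lagrangian, cost]
  dsimp only
  rw [hRs, hnorm, htr]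
  ring

/-- The multiplier `ν` cancels the derivative in the second half of `ψ`; what it adds to the first
half is absorbed by the chain multipliers. -/
lemma hasDerivAt_lagrangian_trd (M : Matrix (Fin (2 * m)) (Fin (2 * m)) ℝ) {x : Var p m}
    (hV : x.2.1ᵀ * x.2.1 = 1)
    (hν : ∀ i, ν i = P.γ * ((x.2.1ᵀ * adj x.1 * x.2.1) (halfIdx i).rev (halfIdx i).rev
      - x.2.2 (halfIdx i).rev))
    (hμ : ∀ i : Fin m, μ₂ i.succ - μ₂ i.castSucc
      = P.γ * (x.2.2 (halfIdx i) - (x.2.1ᵀ * adj x.1 * x.2.1) (halfIdx i) (halfIdx i)) + ν i)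
    (φ : Spectra m) :
    HasDerivAt (fun s : ℝ => lagrangian P μ₁ μ₂ ν M (x + s • ((0, 0, φ) : Var p m))) 0 0 := by
  obtain ⟨w, V, ψ⟩ := x
  dsimp only at hV hν hμ
  obtain ⟨e, he⟩ : ∃ e : Fin (2 * m) → ℝ, ∀ j, (Vᵀ * adj w * V) j j = e j := ⟨_, fun _ => rfl⟩
  simp only [he] at hν hμ
  have hline : ∀ s : ℝ, (w, V, ψ) + s • ((0, 0, φ) : Var p m) = (w, V, ψ + s • φ) := fun s => by
    simp
  have hhalf : ∀ s : ℝ, half (ψ + s • φ) = half ψ + s • half φ := fun s => rfl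
  have hlin : - P.γ * ∑ j, φ j * e j + P.γ * ∑ j, ψ j * φ j
      - ∑ k, μ₂ k * chainGap 0 0 (half φ) k
      + ∑ i, ν i * (φ (halfIdx i) + φ (halfIdx i).rev) = 0 := by
    rw [sum_mul_chainGap, sum_halves, sum_halves]
    simp only [Finset.mul_sum, ← Finset.sum_sub_distrib, ← Finset.sum_add_distrib]
    refine Finset.sum_eq_zero fun i _ => ?_
    rw [hμ, hν, half]
    ring
  refine (hasDerivAt_poly (negLogDet w + (P.K * lap w).trace
    + P.γ / 2 * (‖adj w‖ ^ 2 - 2 * ∑ j, ψ j * e j + ∑ j, ψ j ^ 2)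
    - ∑ e, μ₁ e * w e - ∑ k, μ₂ k * chainGap P.c₁ P.c₂ (half ψ) k
    + ∑ i, ν i * (ψ (halfIdx i) + ψ (halfIdx i).rev) + (Mᵀ * (Vᵀ * V - 1)).trace)
    (- P.γ * ∑ j, φ j * e j + P.γ * ∑ j, ψ j * φ j
      - ∑ k, μ₂ k * chainGap 0 0 (half φ) k
      + ∑ i, ν i * (φ (halfIdx i) + φ (halfIdx i).rev))
    (P.γ / 2 * ∑ j, φ j ^ 2) 0 0).congr_deriv hlin
    |>.congr_of_eventuallyEq (Eventually.of_forall fun s => ?_)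
  dsimp only
  have hsq : ∑ j, (ψ + s • φ) j ^ 2
      = ∑ j, ψ j ^ 2 + s * (2 * ∑ j, ψ j * φ j) + s ^ 2 * ∑ j, φ j ^ 2 := by
    simp only [Finset.mul_sum, ← Finset.sum_add_distrib]
    refine Finset.sum_congr rfl fun j _ => ?_
    simp only [PiLp.add_apply, PiLp.smul_apply, smul_eq_mul]
    ring
  have hcross : ∑ j, (ψ + s • φ) j * e j = ∑ j, ψ j * e j + s * ∑ j, φ j * e j := by
    simp only [Finset.mul_sum, ← Finset.sum_add_distrib]
    refine Finset.sum_congr rfl fun j _ => ?_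
    simp only [PiLp.add_apply, PiLp.smul_apply, smul_eq_mul]
    ring
  have hsym : ∑ i, ν i * ((ψ + s • φ) (halfIdx i) + (ψ + s • φ) (halfIdx i).rev)
      = ∑ i, ν i * (ψ (halfIdx i) + ψ (halfIdx i).rev)
        + s * ∑ i, ν i * (φ (halfIdx i) + φ (halfIdx i).rev) := by
    simp only [Finset.mul_sum, ← Finset.sum_add_distrib]
    refine Finset.sum_congr rfl fun j _ => ?_
    simp only [PiLp.add_apply, PiLp.smul_apply, smul_eq_mul]
    ring
  have hgap : ∑ k, μ₂ k * chainGap P.c₁ P.c₂ (half (ψ + s • φ)) k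
      = ∑ k, μ₂ k * chainGap P.c₁ P.c₂ (half ψ) k
        + s * ∑ k, μ₂ k * chainGap 0 0 (half φ) k := by
    simp only [Finset.mul_sum, ← Finset.sum_add_distrib]
    refine Finset.sum_congr rfl fun k _ => ?_
    rw [hhalf, chainGap_line]
    ring
  rw [hline, lagrangian, cost]
  dsimp only
  rw [norm_sub_sq_eq hV]
  simp only [he]
  rw [hsq, hcross, hsym, hgap]
  ring

theorem mem_kktSet_of_fixed (hγ : 0 < P.γ) {L₂ : ℝ≥0} {x : Var p m} (hx : x ∈ feasible P)
    (hw : wUpdate P L₂ x = x.1)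
    (hV : adj x.1 * x.2.1
      = x.2.1 * Matrix.diagonal fun j => (x.2.1ᵀ * adj x.1 * x.2.1) j j)
    (hψ : IsPsiUpdate P x.1 x.2.1 x.2.2) : x ∈ kktSet P := by
  have hL : 0 < 1 / (2 + (L₂ : ℝ) / P.γ) := by positivity
  -- The factor `2` arises because both halves of `ψ` move with the first.
  obtain ⟨μ₂, hμ0, hμc, hμd⟩ := exists_chain_multipliers hψ.1 hψ.2.1 (c := 2 * P.γ) (by positivity)
  have hgrad : ∀ e, 0 ≤ stepGrad P x e ∧ stepGrad P x e * x.1 e = 0 := by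
    intro e
    have h1 := wUpdate_apply P L₂ x e
    rw [hw] at h1
    rcases le_total 0 (x.1 e - 1 / (2 + (L₂ : ℝ) / P.γ) * stepGrad P x e) with h | h
    · rw [max_eq_left h] at h1
      have : stepGrad P x e = 0 := by
        have : 1 / (2 + (L₂ : ℝ) / P.γ) * stepGrad P x e = 0 := by linarith
        exact (mul_eq_zero.1 this).resolve_left hL.ne'
      rw [this]; simp
    · rw [max_eq_right h] at h1
      rw [h1] at h ⊢
      exact ⟨nonneg_of_mul_nonneg_right (by linarith) hL, mul_zero _⟩
  set Λ : Fin (2 * m) → ℝ := fun j => (x.2.1ᵀ * adj x.1 * x.2.1) j j with hΛ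
  set ν : Fin m → ℝ := fun i => P.γ * (Λ (halfIdx i).rev - x.2.2 (halfIdx i).rev) with hν
  -- The columns of `V` are eigenvectors, so the residual times `V` is `V` times the diagonal matrix
  -- of `Λ - ψ`, and a diagonal `M` suffices.
  set M : Matrix (Fin (2 * m)) (Fin (2 * m)) ℝ :=
    Matrix.diagonal fun j => P.γ * ((Λ j - x.2.2 j) * x.2.2 j) with hM
  refine ⟨hx, fun e => P.γ * stepGrad P x e, μ₂, ν, M, fun e => mul_nonneg hγ.le (hgrad e).1,
    hμ0, fun e => by rw [mul_assoc, (hgrad e).2, mul_zero], hμc, ?_⟩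
  have hd := differentiableAt_lagrangian (P := P) (fun e => P.γ * stepGrad P x e) μ₂ ν M hx.2.1
  refine hasFDerivAt_zero_of_blocks hd
    (hasDerivAt_lagrangian_fst _ _ _ hγ _ hx.2.1 fun _ => rfl)
    (hasDerivAt_lagrangian_snd _ _ _ (Matrix.diagonal_transpose _) ?_)
    (hasDerivAt_lagrangian_trd _ _ _ _ hx.2.2.1 (fun _ => rfl) ?_)
  · rw [Matrix.sub_mul, hV, Matrix.mul_assoc (x.2.1 * _), hx.2.2.1, Matrix.mul_one,
      ← Matrix.mul_sub, Matrix.mul_assoc, ← Matrix.mul_smul, Matrix.diagonal_sub,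
      Matrix.diagonal_mul_diagonal, ← Matrix.diagonal_smul]
    rfl
  · intro i
    rw [hμd]
    have := hψ.2.2 i
    change 2 * P.γ * (x.2.2 (halfIdx i) - (Λ (halfIdx i) - Λ (halfIdx i).rev) / 2)
      = P.γ * (x.2.2 (halfIdx i) - Λ (halfIdx i)) + P.γ * (Λ (halfIdx i).rev
        - x.2.2 (halfIdx i).rev)
    rw [this]
    ring

end Stationarity

/-! ### Coercivity and compactness of the level set. -/

section Compactness

variable {p m : ℕ} {P : Params p}

lemma abs_adj_le (w : Weights p) (i j : Fin p) : |adj w i j| ≤ ‖w‖ := by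
  have h : ∀ e, |w e| ≤ ‖w‖ := fun e => PiLp.norm_apply_le w e
  rw [adj_apply]
  split_ifs
  exacts [h _, h _, by simp]

lemma abs_lap_add_J_le (w : Weights p) (i j : Fin p) :
    |(lap w + J p) i j| ≤ p * ‖w‖ + 1 := by
  have hp : (1 : ℝ) ≤ p := by exact_mod_cast i.pos
  have h1 : |J p i j| ≤ 1 := by
    rw [J, Matrix.of_apply, abs_of_nonneg (by positivity)]
    exact (div_le_one (by positivity)).2 hp
  have h2 : |lap w i j| ≤ p * ‖w‖ := by
    rw [lap_apply]
    split_ifs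
    · refine (Finset.abs_sum_le_sum_abs _ _).trans ?_
      refine (Finset.sum_le_sum fun k _ => abs_adj_le w i k).trans (le_of_eq ?_)
      simp
    · rw [abs_neg]
      exact (abs_adj_le w i j).trans (le_mul_of_one_le_left (norm_nonneg _) hp)
  exact (abs_add_le _ _).trans (add_le_add h2 h1)

/-- The Leibniz expansion bounds the determinant by a polynomial in `‖w‖`, and `log y ≤ y - 1` makes
the bound linear. -/
lemma le_negLogDet {w : Weights p} (h : 0 < (lap w + J p).det) :
    - (Real.log p.factorial + p * (p * ‖w‖)) ≤ negLogDet w := by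
  have h0 : 0 < (p : ℝ) * ‖w‖ + 1 := by positivity
  have h1 : (lap w + J p).det ≤ p.factorial * (p * ‖w‖ + 1) ^ p := by
    have := Matrix.det_le (A := lap w + J p) (abv := AbsoluteValue.abs) (abs_lap_add_J_le w)
    rw [Fintype.card_fin, nsmul_eq_mul] at this
    exact (le_abs_self _).trans this
  have h2 := Real.log_le_log h h1
  rw [Real.log_mul (by positivity) (by positivity), Real.log_pow] at h2
  have h3 := Real.log_le_sub_one_of_pos h0
  have h4 : (p : ℝ) * Real.log (p * ‖w‖ + 1) ≤ p * (p * ‖w‖) :=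
    mul_le_mul_of_nonneg_left (by linarith) (by positivity)
  rw [negLogDet]
  linarith

lemma exists_norm_le_of_cost_le (hγ : 0 < P.γ) (hc₂ : 0 < P.c₂) (c : ℝ) :
    ∃ R, ∀ x ∈ feasible P (m := m), cost P x ≤ c → ‖x.1‖ ≤ R := by
  set D : ℝ := p * p + ‖lapStar P.K‖ with hD
  set E : ℝ := Real.log p.factorial + P.γ / 2 * (2 * m * P.c₁ ^ 2) + c with hE
  have hD0 : 0 ≤ D := by positivity
  -- Chosen to contradict `γ / 2 * ‖w‖ ^ 2 ≤ D * ‖w‖ + E`; the `1` gives `|E| ≤ |E| * ‖w‖` beyond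
  -- this radius.
  refine ⟨1 + 2 * (D + |E|) / P.γ, ?_⟩
  rintro ⟨w, V, ψ⟩ ⟨-, hdet, hV, hψ⟩ hc
  dsimp only at hdet hV hψ ⊢
  have h1 := le_negLogDet hdet
  have h2 : - (‖lapStar P.K‖ * ‖w‖) ≤ (P.K * lap w).trace := by
    rw [trace_mul_lap]
    exact neg_le_of_abs_le (abs_real_inner_le_norm _ _)
  have h3 : ∑ j, ψ j ^ 2 ≤ 2 * m * P.c₁ ^ 2 := by
    refine (Finset.sum_le_sum fun j _ => sq_le_sq.2
      ((abs_le_of_mem hc₂ hψ j).trans (le_abs_self P.c₁))).trans (le_of_eq ?_)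
    simp
  have h4 : ‖w‖ ^ 2 - 2 * m * P.c₁ ^ 2
      ≤ ‖adj w - V * Matrix.diagonal (ψ : Fin (2 * m) → ℝ) * Vᵀ‖ ^ 2 := by
    have hB := norm_sub_sq_eq (A := 0) hV ψ
    simp only [zero_sub, norm_neg, norm_zero, Matrix.mul_zero, Matrix.zero_mul,
      Matrix.zero_apply, mul_zero, Finset.sum_const_zero] at hB
    set B := V * Matrix.diagonal (ψ : Fin (2 * m) → ℝ) * Vᵀ
    have hA : ‖adj w‖ ^ 2 = 2 * ‖w‖ ^ 2 := by rw [frobenius_sq, sum_adj_sq]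
    have htri : ‖adj w‖ ≤ ‖adj w - B‖ + ‖B‖ := by
      simpa using norm_add_le (adj w - B) B
    have := norm_nonneg (adj w)
    nlinarith [sq_nonneg (‖adj w - B‖ - ‖B‖)]
  have h5 : P.γ / 2 * (‖w‖ ^ 2 - 2 * m * P.c₁ ^ 2) ≤ P.γ / 2 *
      ‖adj w - V * Matrix.diagonal (ψ : Fin (2 * m) → ℝ) * Vᵀ‖ ^ 2 :=
    mul_le_mul_of_nonneg_left h4 (by positivity)
  rw [cost] at hc
  dsimp only at hc
  have h6 : P.γ / 2 * ‖w‖ ^ 2 ≤ D * ‖w‖ + E := by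
    rw [hD, hE]
    linarith
  by_contra hlt
  push Not at hlt
  have h7 : (1 + 2 * (D + |E|) / P.γ) * P.γ = P.γ + 2 * (D + |E|) := by field_simp
  have h8 := mul_lt_mul_of_pos_right hlt hγ
  rw [h7] at h8
  have hw1 : 1 < ‖w‖ := lt_of_le_of_lt (le_add_of_nonneg_right (by positivity)) hlt
  have h9 : (P.γ + 2 * (D + |E|)) * ‖w‖ < ‖w‖ * P.γ * ‖w‖ :=
    mul_lt_mul_of_pos_right h8 (by linarith)
  have h10 : |E| ≤ |E| * ‖w‖ := le_mul_of_one_le_right (abs_nonneg _) hw1.le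
  have h11 := le_abs_self E
  have h12 : 0 < P.γ * ‖w‖ := by positivity
  nlinarith

lemma isClosed_chainSet (c₁ c₂ : ℝ) : IsClosed (chainSet m c₁ c₂) := by
  rw [show chainSet m c₁ c₂ = ⋂ k, {x | 0 ≤ chainGap c₁ c₂ x k} by ext; simp [chainSet]]
  exact isClosed_iInter fun k =>
    isClosed_le continuous_const (differentiable_chainGap c₁ c₂ k).continuous

lemma continuous_half : Continuous (half (m := m)) :=
  continuous_pi fun i => by unfold half; fun_prop

lemma isClosed_spectralSet (c₁ c₂ : ℝ) : IsClosed (spectralSet m c₁ c₂) := by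
  have h : IsClosed (⋂ i : Fin m, {ψ : Spectra m | ψ (halfIdx i) = - ψ (halfIdx i).rev}) :=
    isClosed_iInter fun i => isClosed_eq (by fun_prop) (by fun_prop)
  convert h.inter ((isClosed_chainSet c₁ c₂).preimage continuous_half) using 1
  ext ψ
  simp [spectralSet]

theorem isCompact_levelSet (hγ : 0 < P.γ) (hc₂ : 0 < P.c₂) (x₀ : Var p m) :
    IsCompact (levelSet P x₀) := by
  have : ProperSpace (Var p m) := FiniteDimensional.proper ℝ _
  have hclosed : IsClosed (levelSet P x₀) := by
    have h1 : IsClosed {x : Var p m | ∀ e, 0 ≤ x.1 e} := by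
      rw [show {x : Var p m | ∀ e, 0 ≤ x.1 e} = ⋂ e, {x : Var p m | 0 ≤ x.1 e} by ext; simp]
      exact isClosed_iInter fun e => isClosed_le continuous_const (by fun_prop)
    have h2 : IsClosed {x : Var p m | x.2.1ᵀ * x.2.1 = 1} :=
      isClosed_eq (by fun_prop) continuous_const
    have h3 : IsClosed {x : Var p m | x.2.2 ∈ spectralSet m P.c₁ P.c₂} :=
      (isClosed_spectralSet P.c₁ P.c₂).preimage (by fun_prop)
    convert ((h1.inter h2).inter h3).inter (isClosed_cost_le P (m := m) (cost P x₀)) using 1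
    ext x
    simp only [levelSet, feasible, Set.mem_inter_iff, Set.mem_ofPred_eq]
    tauto
  obtain ⟨R, hR⟩ := exists_norm_le_of_cost_le (m := m) hγ hc₂ (cost P x₀)
  refine Metric.isCompact_of_isClosed_isBounded hclosed (isBounded_iff_forall_norm_le.2
    ⟨max R (max (√(2 * m)) (√(2 * m * P.c₁ ^ 2))), fun x hx => ?_⟩)
  refine max_le_max (hR x hx.1 hx.2) (max_le_max ?_ ?_)
  · refine Real.le_sqrt_of_sq_le (le_of_eq ?_)
    rw [frobenius_sq]
    simp_rw [sq]
    rw [sum_mul_eq_trace, Matrix.trace_mul_comm, hx.1.2.2.1]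
    simp
  · refine Real.le_sqrt_of_sq_le ?_
    rw [EuclideanSpace.norm_sq_eq]
    refine (Finset.sum_le_sum fun j _ => ?_).trans
      (le_of_eq (b := ∑ _j : Fin (2 * m), P.c₁ ^ 2) rfl) |>.trans (le_of_eq (by simp))
    rw [Real.norm_eq_abs]
    exact pow_le_pow_left₀ (abs_nonneg _) (abs_le_of_mem hc₂ hx.1.2.2.2 j) 2

lemma continuousOn_cost : ContinuousOn (cost P (m := m)) (feasible P) := by
  rw [show cost P (m := m) = _ from funext (cost_eq P)]
  refine ContinuousOn.add (fun x hx => ?_) (continuous_quadCost P).continuousOn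
  exact ((differentiableAt_negLogDet hx.2.1.ne').continuousAt.comp
    continuousAt_fst).continuousWithinAt

end Compactness

/-! ### Passage to the limit. -/

section Convergence

variable {p m z : ℕ} {hp : p = 2 * m + z} {P : Params p} {L₂ : ℝ≥0}

lemma continuousAt_wUpdate {y : Var p m} (hy : 0 < (lap y.1 + J p).det) :
    ContinuousAt (wUpdate P L₂) y := by
  have h1 : ContinuousAt (fun x : Var p m => (lap x.1 + J p)⁻¹) y := by
    simp only [Matrix.inv_def, Ring.inverse_eq_inv']
    have hdet : Continuous fun x : Var p m => (lap x.1 + J p).det :=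
      continuous_det_lap continuous_fst
    have hadj : Continuous fun x : Var p m => (lap x.1 + J p).adjugate := by fun_prop
    exact (hdet.continuousAt.inv₀ hy.ne').smul hadj.continuousAt
  have h2 : ∀ i j, ContinuousAt (fun x : Var p m => (lap x.1 + J p)⁻¹ i j) y := fun i j =>
    (continuous_apply_apply i j).continuousAt.comp h1
  have h3 : ∀ e, ContinuousAt (fun x : Var p m => stepGrad P x e) y := by
    intro e
    simp only [stepGrad, cTilde, lapStar, adjStar, PiLp.sub_apply, PiLp.add_apply, PiLp.neg_apply,
      PiLp.smul_apply, smul_eq_mul]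
    refine ContinuousAt.sub (ContinuousAt.add (ContinuousAt.neg (continuousAt_const.mul
      ((((h2 _ _).sub (h2 _ _)).sub (h2 _ _)).add (h2 _ _)))) ?_) ?_
    · exact Continuous.continuousAt (by fun_prop)
    · refine Continuous.continuousAt ?_
      simp only [Matrix.mul_apply, Matrix.diagonal_apply, Matrix.transpose_apply, mul_ite,
        mul_zero, Finset.sum_ite_eq', Finset.mem_univ, if_true]
      fun_prop
  refine (PiLp.continuous_toLp 2 _).continuousAt.comp (continuousAt_pi.2 fun e => ?_)
  have h4 : ContinuousAt (fun x : Var p m => x.1 e) y := Continuous.continuousAt (by fun_prop)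
  exact (h4.sub (continuousAt_const.mul (h3 e))).max continuousAt_const

lemma isClosed_isPsiUpdate :
    IsClosed {x : Var p m | IsPsiUpdate P x.1 x.2.1 x.2.2} := by
  have hhalf : Continuous fun x : Var p m => half x.2.2 := continuous_half.comp (by fun_prop)
  have he : ∀ j, Continuous fun x : Var p m => (x.2.1ᵀ * adj x.1 * x.2.1) j j := fun j => by
    fun_prop
  have h₁ : IsClosed {x : Var p m | half x.2.2 ∈ chainSet m P.c₁ P.c₂} :=
    (isClosed_chainSet P.c₁ P.c₂).preimage hhalf
  have h₂ : IsClosed (⋂ y ∈ chainSet m P.c₁ P.c₂, {x : Var p m |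
      ∑ i, (half x.2.2 i - ((x.2.1ᵀ * adj x.1 * x.2.1) (halfIdx i) (halfIdx i)
        - (x.2.1ᵀ * adj x.1 * x.2.1) (halfIdx i).rev (halfIdx i).rev) / 2) ^ 2
      ≤ ∑ i, (y i - ((x.2.1ᵀ * adj x.1 * x.2.1) (halfIdx i) (halfIdx i)
        - (x.2.1ᵀ * adj x.1 * x.2.1) (halfIdx i).rev (halfIdx i).rev) / 2) ^ 2}) := by
    refine isClosed_biInter fun y _ => isClosed_le ?_ ?_
    · exact continuous_finsetSum _ fun i _ => Continuous.pow
        (((continuous_apply i).comp hhalf).sub (((he _).sub (he _)).div_const 2)) 2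
    · exact continuous_finsetSum _ fun i _ =>
        Continuous.pow (continuous_const.sub (((he _).sub (he _)).div_const 2)) 2
  have h₃ : IsClosed (⋂ i : Fin m, {x : Var p m | x.2.2 (halfIdx i).rev = - x.2.2 (halfIdx i)}) :=
    isClosed_iInter fun i => isClosed_eq (by fun_prop) (by fun_prop)
  convert h₁.inter (h₂.inter h₃) using 1
  ext x
  simp [IsPsiUpdate, isMinOn_iff]

lemma IsStep.mem_levelSet_and_cost_le (hγ : 0 < P.γ) (hc₂ : 0 < P.c₂) {x₀ x x' : Var p m}
    (hL₂ : LipschitzOnWith L₂ (gradient (negLogDet (p := p))) (Prod.fst '' levelSet P x₀))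
    (hx : x ∈ levelSet P x₀) (h : IsStep hp P L₂ x x') :
    x' ∈ levelSet P x₀ ∧
      cost P x' ≤ cost P x - (2 * P.γ + L₂) / 2 * ‖x'.1 - x.1‖ ^ 2 := by
  obtain ⟨w', V', ψ'⟩ := x'
  obtain ⟨hw, hV, hψ⟩ := h
  dsimp only at hw hV hψ ⊢
  subst hw
  obtain ⟨hdet, hdesc⟩ := cost_wUpdate_le P hγ hL₂ hx
  have h1 := hV.cost_le hγ hc₂ hx.1.2.2.1 hx.1.2.2.2
  have h2 := hψ.cost_le hγ hV.transpose_mul_self hx.1.2.2.2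
  have h3 := (h2.trans h1).trans hdesc
  refine ⟨⟨⟨fun e => ?_, hdet, hV.transpose_mul_self, hψ.mem⟩, ?_⟩, h3⟩
  · rw [wUpdate_apply]
    exact le_max_right _ _
  · have : 0 ≤ (2 * P.γ + L₂) / 2 * ‖wUpdate P L₂ x - x.1‖ ^ 2 := by positivity
    linarith [hx.2]

lemma tendsto_sub_of_sufficient_decrease {E : Type*} [NormedAddCommGroup E] {u : ℕ → E}
    {f : ℕ → ℝ} {a : ℝ} (ha : 0 < a) (hf : BddBelow (Set.range f))
    (h : ∀ t, f (t + 1) ≤ f t - a * ‖u (t + 1) - u t‖ ^ 2) :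
    Tendsto (fun t => u (t + 1) - u t) atTop (𝓝 0) := by
  have hanti : Antitone f := antitone_nat_of_succ_le fun t =>
    (h t).trans (sub_le_self _ (by positivity))
  have hlim := tendsto_atTop_ciInf hanti hf
  have hdiff : Tendsto (fun t => (f t - f (t + 1)) / a) atTop (𝓝 0) := by
    simpa using (hlim.sub (hlim.comp (tendsto_add_atTop_nat 1))).div_const a
  have hsq : Tendsto (fun t => ‖u (t + 1) - u t‖ ^ 2) atTop (𝓝 0) := by
    refine squeeze_zero (fun t => by positivity) (fun t => ?_) hdiff
    rw [le_div_iff₀ ha]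
    linarith [h t]
  rw [tendsto_zero_iff_norm_tendsto_zero]
  simpa using hsq.sqrt

/-- Iterates staying away from `S` infinitely often would cluster in `K` outside `S`. The extended
distance to the empty set is `⊤`, so the conclusion also contains that `S` is nonempty. -/
lemma tendsto_infEDist_of_mapClusterPt {E : Type*} [PseudoEMetricSpace E] {K S : Set E}
    (hK : IsCompact K) {x : ℕ → E} (hx : ∀ t, x t ∈ K)
    (h : ∀ y, MapClusterPt y atTop x → y ∈ S) :
    Tendsto (fun t => Metric.infEDist (x t) S) atTop (𝓝 0) := by
  rw [ENNReal.tendsto_nhds_zero]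
  intro ε hε
  by_contra hcon
  have hfreq : ∃ᶠ t in atTop, x t ∈ K ∩ {y | ε ≤ Metric.infEDist y S} :=
    (not_eventually.1 hcon).mono fun t ht => ⟨hx t, (not_le.1 ht).le⟩
  obtain ⟨y, hy, hcl⟩ := (hK.inter_right (isClosed_le continuous_const
    Metric.continuous_infEDist)).exists_mapClusterPt_of_frequently hfreq
  have : ε ≤ Metric.infEDist y S := hy.2
  rw [Metric.infEDist_zero_of_mem (h y hcl)] at this
  exact hε.not_ge this

end Convergence

end SGA

theorem mainTheorem2 {p m z : ℕ} (hp : p = 2 * m + z) (P : SGA.Params p)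
    (hγ : 0 < P.γ) (hc₁ : 0 < P.c₁) (hc₂ : 0 < P.c₂)
    (x : ℕ → SGA.Var p m) (L₂ : ℝ≥0)
    (hx₀ : x 0 ∈ SGA.feasible P)
    (hL₂ : LipschitzOnWith L₂ (gradient (SGA.negLogDet (p := p)))
      (Prod.fst '' SGA.levelSet P (x 0)))
    (hx : ∀ t, SGA.IsStep hp P L₂ (x t) (x (t + 1))) :
    Filter.Tendsto (fun t => Metric.infEDist (x t) (SGA.kktSet P)) Filter.atTop (𝓝 0) ∧
      ∀ y : SGA.Var p m, MapClusterPt y Filter.atTop x → y ∈ SGA.kktSet P := by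
  open SGA Filter in
  have hK := isCompact_levelSet hγ hc₂ (x 0)
  have hmem : ∀ t, x t ∈ levelSet P (x 0) := by
    intro t
    induction t with
    | zero => exact ⟨hx₀, le_rfl⟩
    | succ t ih => exact ((hx t).mem_levelSet_and_cost_le hγ hc₂ hL₂ ih).1
  have hbdd : BddBelow (Set.range fun t => cost P (x t)) := by
    refine (hK.bddBelow_image (continuousOn_cost.mono fun y hy => hy.1)).mono ?_
    rintro _ ⟨t, rfl⟩
    exact ⟨x t, hmem t, rfl⟩
  have hstep : Tendsto (fun t => (x (t + 1)).1 - (x t).1) atTop (𝓝 0) :=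
    tendsto_sub_of_sufficient_decrease (u := fun t => (x t).1)
      (a := (2 * P.γ + L₂) / 2) (by positivity) hbdd
      fun t => ((hx t).mem_levelSet_and_cost_le hγ hc₂ hL₂ (hmem t)).2
  have hclus : ∀ y : Var p m, MapClusterPt y atTop x → y ∈ kktSet P := by
    intro y hy
    -- The ultrafilter plays the role of a convergent subsequence.
    obtain ⟨U, hU, hlim⟩ := mapClusterPt_iff_ultrafilter.1 hy
    have hyK : y ∈ levelSet P (x 0) := hK.isClosed.mem_of_tendsto hlim (Eventually.of_forall hmem)
    have hlim₁ : Tendsto (fun t => (x t).1) U (𝓝 y.1) := (continuous_fst.tendsto y).comp hlim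
    -- The starting point is not the output of a step, so its `V` and `ψ` need not fit its `w`.
    have hpos : ∀ᶠ t in U, ∃ s, t = s + 1 :=
      Filter.Eventually.filter_mono hU ((eventually_ge_atTop 1).mono fun t ht => ⟨t - 1, by omega⟩)
    refine mem_kktSet_of_fixed (L₂ := L₂) hγ hyK.1 ?_ ?_ ?_
    · have h1 : Tendsto (fun t => (x (t + 1)).1) U (𝓝 y.1) := by
        simpa using (hstep.mono_left hU).add hlim₁
      have h2 := (continuousAt_wUpdate (P := P) (L₂ := L₂) hyK.1.2.1).tendsto.comp hlim
      exact tendsto_nhds_unique (h2.congr fun t => ((hx t).1).symm) h1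
    · have hcl : IsClosed {x : Var p m | adj x.1 * x.2.1
          = x.2.1 * Matrix.diagonal fun j => (x.2.1ᵀ * adj x.1 * x.2.1) j j} :=
        isClosed_eq (by fun_prop) (by fun_prop)
      refine hcl.mem_of_tendsto hlim (hpos.mono ?_)
      rintro _ ⟨s, rfl⟩
      exact (hx s).2.1.exists_eigenvalues
    · refine (isClosed_isPsiUpdate (P := P)).mem_of_tendsto hlim (hpos.mono ?_)
      rintro _ ⟨s, rfl⟩
      exact (hx s).2.2
  exact ⟨tendsto_infEDist_of_mapClusterPt hK hmem hclus, hclus⟩
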